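/- Let $M$ be a prime and $1\le N<M$. Consider $N$ photons in $M$ modes $0,\dots,M-1$ (indices mod $M$), and put $\omega=e^{2\pi i/M}$. A linear-optical mode transformation with matrix $A$ acts by $\hat a_m^\dagger\mapsto\sum_{m'}A_{m'm}\hat a_{m'}^\dagger$. The mode shift $\hat X$ is $\hat a_m^\dagger\mapsto\hat a_{m+1}^\dagger$, the phase shift $\hat Z$ is $\hat a_m^\dagger\mapsto\omega^m\hat a_m^\dagger$, and the Heisenberg–Weyl (HW) operators are $\hat\Lambda_{k,l}=\hat X^k\hat Z^l$. Let $L_{k,l}$ be the $M\times M$ matrix of $\hat\Lambda_{k,l}$ on one photon, $L_{k,l}(m,m')=\langle 1_m|\hat\Lambda_{k,l}|1_{m'}\rangle$. For an $N$-photon density operator $\hat\rho$ write $\langle\hat\Lambda_{k,l}\rangle_\rho=\mathrm{tr}(\hat\rho\,\hat\Lambda_{k,l})$. A generalized Hadamard transform $\hat H_{1,0}$ is a unitary mode transformation with $\hat\Lambda_{1,0}=\hat H_{1,0}\hat Z\hat H_{1,0}^\dagger$. The HW-reduced density matrix is $\rho_{HW}=\sum_{\mathbb E}p_{\mathbb E}\,\rho^{(\mathbb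 E)}_{HW}$, where $\mathbb E$ runs over the orbits of Fock vectors $\boldsymbol n$ under $\hat X$, $p_{\mathbb E}=\sum_{\boldsymbol n\in\mathbb E}\langle\boldsymbol n|\hat\rho|\boldsymbol n\rangle$, $\rho^{(\mathbb E)}_{HW}[m,m']=\frac{|\mathbb E|}{M\,p_{\mathbb E}}\langle\hat X^m\tilde{\boldsymbol n}|\hat\rho|\hat X^{m'}\tilde{\boldsymbol n}\rangle$, and $\tilde{\boldsymbol n}\in\mathbb E$ is the representative with $\sum_m m\,\tilde n_m\equiv0\pmod M$ (orbits with $p_{\mathbb E}=0$ contribute $0$). DQC1 measurement in the configuration $(\hat W,\hat V)$: feed $\hat\rho$ into arm $A$ ($M$ modes) and the vacuum into arm $B$ ($M$ modes), apply the interferometer $(\hat W^\dagger\oplus 1)\hat H^\dagger(1\oplus\hat V)\hat H(\hat W\oplus 1)$, where $\hat H$ is the multimode beam splitter with mode matrix $\frac1{\sqrt2}\begin{pmatrix}1&1\\1&-1\end{pmatrix}$ on the two arms, measure the total photon numbers $N_A,N_B$ of the two arms with two bucket photon-number-resolving detectors, and set $\langle\hat\zeta(\hat W^\dagger\hat V\hat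 W)\rangle_{\mathrm{DQC1}}=\sum_{N_B}(-1)^{N_B}p(N_B\mid N_A+N_B=N)$. Let $\theta_r=-r\pi/(2N)$, $\varphi_{km}=2\pi km/M$, $\hat V_{r,k,l,m}=e^{i(\theta_r+\varphi_{km})\hat N}\hat\Lambda_{k,l}$ with $\hat N$ the total photon number operator, and let $\delta_k=1$ if $2kN\equiv0\pmod M$ and $\delta_k=0$ otherwise. Put $$E_r(\hat W;k,l)=\frac{2^{N-\delta_k}}{M}\sum_{m=0}^{M-1}\cos\Big(\frac{2\pi}{M}kmN\Big)\big\langle\hat\zeta(\hat W^\dagger\hat V_{r,k,l,m}\hat W)\big\rangle_{\mathrm{DQC1}}.$$ Then a generalized Hadamard transform $\hat H_{1,0}$ exists, and, for any choice of it and every $N$-photon density operator $\hat\rho$: 1. $\displaystyle\rho_{HW}=\frac1M\sum_{k,l=0}^{M-1}\langle\hat\Lambda_{k,l}\rangle_\rho\,L_{k,Nl}^\dagger$. 2. For $1\le k<M$ and $0\le l<M$: $\mathrm{Re}\langle\hat\Lambda_{k,l}\rangle_\rho=E_0(1;k,l)$ and $\mathrm{Im}\langle\hat\Lambda_{k,l}\rangle_\rho=E_1(1;k,l)$.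 3. For $1\le l<M$: $\mathrm{Re}\langle\hat\Lambda_{0,l}\rangle_\rho=E_0(\hat H_{1,0};l,0)$ and $\mathrm{Im}\langle\hat\Lambda_{0,l}\rangle_\rho=E_1(\hat H_{1,0};l,0)$; and $\langle\hat\Lambda_{0,0}\rangle_\rho=1$. 4. The set of configurations $(\hat W,\hat V)$ used in 2 and 3 has exactly $2M^3-2M$ elements, and $\rho_{HW}$ is a function, the same for all $\hat\rho$, of the values $\langle\hat\zeta\rangle_{\mathrm{DQC1}}$ measured in these configurations. -/

import Mathlib

open scoped Matrix ComplexOrder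

noncomputable section

namespace HWReconstruction

/-! ### Fock space and linear optical networks -/

/-- The Fock basis of `N` photons in the modes `ι`: occupation vectors `n : ι →₀ ℕ` with total
photon number `N`. -/
abbrev Fock (ι : Type) [Fintype ι] [DecidableEq ι] (N : ℕ) : Type :=
  ↥(Finset.finsuppAntidiag (Finset.univ : Finset ι) N)

/-- The factorial `n! = ∏ i, (n i)!` of an occupation vector. -/
def occFactorial {ι : Type} [Fintype ι] (n : ι →₀ ℕ) : ℝ :=
  ((∏ i, (n i).factorial : ℕ) : ℝ)

/-- The operator on the `N`-photon space induced by the mode transformation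
`a†_m ↦ ∑ m', A m' m • a†_m'`, in the Fock basis. Since `|n⟩ = ∏ m, (a†_m)^(n m) / √(n!) |0⟩`, the
entry `⟨ν| Â |n⟩` is `√(ν!) / √(n!)` times the coefficient of `∏ m, (a†_m)^(ν m)` in
`∏ m, (∑ m', A m' m • a†_m')^(n m)`; creation operators commute, so they are polynomial variables
here. -/
def fockOp {ι : Type} [Fintype ι] [DecidableEq ι] (N : ℕ) (A : Matrix ι ι ℂ) :
    Matrix (Fock ι N) (Fock ι N) ℂ :=
  Matrix.of fun ν n =>
    ((Real.sqrt (occFactorial ν.1) / Real.sqrt (occFactorial n.1) : ℝ) : ℂ) *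
      MvPolynomial.coeff ν.1
        (∏ m, (∑ m', MvPolynomial.C (A m' m) * MvPolynomial.X m') ^ (n.1 m))

/-- Density operators. -/
def IsDensity {κ : Type} [Fintype κ] (ρ : Matrix κ κ ℂ) : Prop :=
  ρ.PosSemidef ∧ ρ.trace = 1

/-- The expectation value `⟨Â⟩_ρ = tr(ρ Â)` of the operator induced by a mode transformation. -/
def expect {ι : Type} [Fintype ι] [DecidableEq ι] {N : ℕ}
    (ρ : Matrix (Fock ι N) (Fock ι N) ℂ) (A : Matrix ι ι ℂ) : ℂ :=
  (ρ * fockOp N A).trace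

/-! ### Heisenberg-Weyl operators -/

section HW

variable (M : ℕ) [NeZero M]

/-- `ω = exp(2πi/M)`. -/
def omega : ℂ := Complex.exp (2 * Real.pi * Complex.I / M)

/-- Mode matrix of the mode shift, `a†_m ↦ a†_(m+1 mod M)`. -/
def modeX : Matrix (ZMod M) (ZMod M) ℂ :=
  Matrix.of fun m' m => if m' = m + 1 then 1 else 0

/-- Mode matrix of the phase shift, `a†_m ↦ ω^m a†_m`. -/
def modeZ : Matrix (ZMod M) (ZMod M) ℂ :=
  Matrix.diagonal fun m => omega M ^ m.val

/-- Mode matrix of the Heisenberg-Weyl operator `Λ_{k,l} = X^k Z^l`. -/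
def modeHW (k l : ℕ) : Matrix (ZMod M) (ZMod M) ℂ :=
  modeX M ^ k * modeZ M ^ l

/-- The Fock vector with one photon in mode `m` and none elsewhere. -/
def singlePhoton (m : ZMod M) : Fock (ZMod M) 1 :=
  ⟨Finsupp.single m 1, by simp [Finset.mem_finsuppAntidiag]⟩

/-- The single-photon matrix `L_{k,l}(m, m') = ⟨1_m| Λ_{k,l} |1_m'⟩`. -/
def hwL (k l : ℕ) : Matrix (ZMod M) (ZMod M) ℂ :=
  Matrix.of fun m m' => fockOp 1 (modeHW M k l) (singlePhoton M m) (singlePhoton M m')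

variable {M}

/-- `H` is a generalized Hadamard transform `H_{k,l}`: a unitary mode transformation with
`Λ_{k,l} = H Z H†`. -/
def IsGenHadamard (H : Matrix (ZMod M) (ZMod M) ℂ) (k l : ℕ) : Prop :=
  H ∈ Matrix.unitaryGroup (ZMod M) ℂ ∧ modeHW M k l = H * modeZ M * Hᴴ

/-! ### The HW-reduced density matrix -/

variable {N : ℕ}

/-- The Fock vector `X^m n`: every photon is moved cyclically by `m` modes. -/
def shiftFock (m : ZMod M) (n : Fock (ZMod M) N) : Fock (ZMod M) N :=
  ⟨Finsupp.equivMapDomain (Equiv.addRight m) n.1, by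
    have h := n.2
    rw [Finset.mem_finsuppAntidiag] at h ⊢
    refine ⟨?_, Finset.subset_univ _⟩
    refine Eq.trans ?_ h.1
    exact Fintype.sum_equiv (Equiv.addRight m).symm _ _ fun x => by
      simp [Finsupp.equivMapDomain_apply]⟩

/-- The total mode index `μ(n) = ∑ m, m * n m` modulo `M`. -/
def modeIndex (n : Fock (ZMod M) N) : ZMod M := ∑ m : ZMod M, m * (n.1 m : ZMod M)

/-- The set `E_n = {X^m n}` of Fock vectors that spans the HW subspace of `n`. -/
def hwOrbit (n : Fock (ZMod M) N) : Finset (Fock (ZMod M) N) :=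
  Finset.univ.image fun m : ZMod M => shiftFock m n

variable (M N) in
/-- The collection of all the sets `E_n`. -/
def hwOrbits : Finset (Finset (Fock (ZMod M) N)) :=
  Finset.univ.image hwOrbit

/-- The weight `p_E = tr(Π_E ρ Π_E)`. -/
def hwWeight (ρ : Matrix (Fock (ZMod M) N) (Fock (ZMod M) N) ℂ)
    (E : Finset (Fock (ZMod M) N)) : ℂ :=
  ∑ n ∈ E, ρ n n

open Classical in
/-- The block `ρ_HW^(E)[m, m'] = d_E / (M p_E) ⟨X^m ñ| ρ |X^m' ñ⟩`, where `ñ` is the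
representative of `E` with `μ(ñ) = 0`. For `gcd(N, M) = 1` every `E` has exactly one
representative, so the `else` branch is void. -/
def hwBlock (ρ : Matrix (Fock (ZMod M) N) (Fock (ZMod M) N) ℂ)
    (E : Finset (Fock (ZMod M) N)) : Matrix (ZMod M) (ZMod M) ℂ :=
  Matrix.of fun m m' =>
    if h : ∃ n ∈ E, modeIndex n = 0 then
      (E.card : ℂ) / (M * hwWeight ρ E) * ρ (shiftFock m h.choose) (shiftFock m' h.choose)
    else 0

/-- The HW-reduced density matrix `ρ_HW = ∑ E, p_E ρ_HW^(E)`. -/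
def hwReduced (ρ : Matrix (Fock (ZMod M) N) (Fock (ZMod M) N) ℂ) :
    Matrix (ZMod M) (ZMod M) ℂ :=
  ∑ E ∈ hwOrbits M N, hwWeight ρ E • hwBlock ρ E

end HW

/-! ### The DQC1 measurement with two bucket detectors -/

section DQC1

variable {ι : Type} [Fintype ι] [DecidableEq ι] {N : ℕ}

variable (ι) in
/-- The multimode beam splitter between the arms `A` (`Sum.inl`) and `B` (`Sum.inr`). -/
def beamSplitter : Matrix (ι ⊕ ι) (ι ⊕ ι) ℂ :=
  ((1 / Real.sqrt 2 : ℝ) : ℂ) • Matrix.fromBlocks 1 1 1 (-1)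

/-- The mode matrix `T(W, V) = (W† ⊕ 1) H† (1 ⊕ V) H (W ⊕ 1)` of the DQC1 interferometer, with
`H` the multimode beam splitter. -/
def dqc1Interferometer (W V : Matrix ι ι ℂ) : Matrix (ι ⊕ ι) (ι ⊕ ι) ℂ :=
  Matrix.fromBlocks Wᴴ 0 0 1 * (beamSplitter ι)ᴴ * Matrix.fromBlocks 1 0 0 V *
    beamSplitter ι * Matrix.fromBlocks W 0 0 1

variable (ι N) in
/-- The isometry `|n⟩ ↦ |n⟩_A ⊗ |0⟩_B`. -/
def injectA : Matrix (Fock (ι ⊕ ι) N) (Fock ι N) ℂ :=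
  Matrix.of fun x n => if (∀ i, x.1 (Sum.inl i) = n.1 i) ∧ (∀ i, x.1 (Sum.inr i) = 0)
    then 1 else 0

/-- The output state of the interferometer on the input `ρ` in arm `A` and vacuum in arm `B`. -/
def dqc1Output (ρ : Matrix (Fock ι N) (Fock ι N) ℂ) (W V : Matrix ι ι ℂ) :
    Matrix (Fock (ι ⊕ ι) N) (Fock (ι ⊕ ι) N) ℂ :=
  fockOp N (dqc1Interferometer W V) * (injectA ι N * ρ * (injectA ι N)ᴴ) *
    (fockOp N (dqc1Interferometer W V))ᴴ

/-- The probability that the two bucket detectors count `NA` photons in arm `A` and `NB` photons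
in arm `B`. -/
def detectProb (ρ : Matrix (Fock ι N) (Fock ι N) ℂ) (W V : Matrix ι ι ℂ) (NA NB : ℕ) : ℝ :=
  ∑ x : Fock (ι ⊕ ι) N,
    if (∑ i, x.1 (Sum.inl i) = NA) ∧ (∑ i, x.1 (Sum.inr i) = NB)
      then (dqc1Output ρ W V x x).re else 0

/-- The conditional probability `p(NB | NA + NB = N)`. -/
def condProb (ρ : Matrix (Fock ι N) (Fock ι N) ℂ) (W V : Matrix ι ι ℂ) (NB : ℕ) : ℝ :=
  detectProb ρ W V (N - NB) NB / ∑ j ∈ Finset.range (N + 1), detectProb ρ W V (N - j) j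

/-- The measured value `⟨ζ(W† V W)⟩_DQC1 = ∑ NB, (-1)^NB p(NB | NA + NB = N)`. -/
def dqc1Z (ρ : Matrix (Fock ι N) (Fock ι N) ℂ) (W V : Matrix ι ι ℂ) : ℝ :=
  ∑ NB ∈ Finset.range (N + 1), (-1) ^ NB * condProb ρ W V NB

end DQC1

/-! ### Measurement configurations -/

section Configurations

variable (M N : ℕ) [NeZero M]

/-- `θ_r = -rπ/(2N)`. -/
def theta (r : ℕ) : ℝ := -(r * Real.pi / (2 * N))

/-- `φ_{km} = km(2π/M)`. -/
def phi (k m : ℕ) : ℝ := k * m * (2 * Real.pi / M)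

/-- Mode matrix of `V_{r,k,l,m} = exp(i(θ_r + φ_{km}) N̂) Λ_{k,l}`. The number operator `N̂`
counts photons, so `exp(iα N̂)` is the mode transformation `a†_m ↦ exp(iα) a†_m`. -/
def modeV (r k l m : ℕ) : Matrix (ZMod M) (ZMod M) ℂ :=
  Complex.exp (((theta N r + phi M k m : ℝ) : ℂ) * Complex.I) • modeHW M k l

variable {M N} in
/-- The combination
`2^(N - δ) / M * ∑ m < M, cos(2πkmN/M) ⟨ζ(W† V_{r,k,l,m} W)⟩_DQC1` of measured values, where `δ` is
`1` if `2kN = 0 mod M` and `0` otherwise. -/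
def dqc1Eval (ρ : Matrix (Fock (ZMod M) N) (Fock (ZMod M) N) ℂ)
    (W : Matrix (ZMod M) (ZMod M) ℂ) (r k l : ℕ) : ℝ :=
  (2 : ℝ) ^ ((N : ℤ) - if M ∣ 2 * k * N then 1 else 0) / M *
    ∑ m ∈ Finset.range M,
      Real.cos (2 * Real.pi / M * k * m * N) * dqc1Z ρ W (modeV M N r k l m)

variable {M} in
/-- The configurations `(W, V)` of the scheme, for a given `H = H_{1,0}`: those for `Λ_{k,l}` with
`k ≥ 1`, namely `(1, V_{r,k,l,m})`, and those for `Λ_{0,l}` with `l ≥ 1`, namely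
`(H, V_{r,l,0,m})`. -/
def configurations (H : Matrix (ZMod M) (ZMod M) ℂ) :
    Set (Matrix (ZMod M) (ZMod M) ℂ × Matrix (ZMod M) (ZMod M) ℂ) :=
  {c | ∃ r k l m : ℕ, r < 2 ∧ 1 ≤ k ∧ k < M ∧ l < M ∧ m < M ∧ c = (1, modeV M N r k l m)} ∪
  {c | ∃ r l m : ℕ, r < 2 ∧ 1 ≤ l ∧ l < M ∧ m < M ∧ c = (H, modeV M N r l 0 m)}

end Configurations

end HWReconstruction

end

/-!
**Fock space.** `fockOp N` respects products and adjoints of mode matrices. Products are compositions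
of substitutions in polynomials (`fockOp_mul`). Adjoints reduce to transposes, which come from the
symmetry of the generating form `(∑ A m' m x_m' y_m)^N` (`fockOp_transpose`).

**DQC1.** The observable `(-1)^N_B` is itself induced by a mode transformation, the sign flip of
arm `B`. Pulling it back through the interferometer and compressing to arm `A` gives the mode matrix
`(U + U†)/2` with `U = W† V W`, so the measured value is `Re ⟨(U + U†)/2⟩`, with the bracket denoting
the induced operator on `N` photons (`dqc1Z_eq`).

**Phase average.** For a phase `c`, the operator induced by `(c U + c⁻¹ U†)/2` is a Laurent
polynomial `2^(-N) ∑ j ≤ N, c^(N-2j) Q_j` whose extremal coefficients `Q_0`, `Q_N` are induced by `U`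
and `U†` (`exists_fockOp_add_smul`). Averaging over `c = exp(iθ) ω^(km)` against `cos(2πkmN/M)` keeps
the `j` with `2k(N-j) ≡ 0` or `2kj ≡ 0 (mod M)`. As `M` is prime and `k, N < M`, these are `j = 0`
and `j = N`; for `M = 2` both are met twice (`sum_extremal`). What remains is
`Re (exp(iNθ) ⟨U⟩)`, the real or the imaginary part of `⟨U⟩` (`dqc1Eval_eq`). With `W = 1` the matrix
`U` is `Λ_{k,l}`; with `W = H_{1,0}` and `V` built from `X^l` it is `Z^l`.

**Reconstruction.** `⟨Λ_{k,l}⟩ = ∑ n, ω^(l μ(n)) ⟨n|ρ|X^k n⟩` (`expect_modeHW`), so the Fourier sum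
over `l` selects the `n` with a given `μ(n)` (`reconstruction_apply`). Since `μ(X^m n) = μ(n) + N m`
and `N` is invertible modulo `M`, each orbit has `M` elements and exactly one of them has `μ = 0`,
and the selected terms are the blocks of `ρ_HW` (`hwReduced_eq`). Orbits of weight zero contribute
nothing on either side, because `ρ` is positive semidefinite.

**Counting.** The entries of `V_{r,k,l,m}` determine `k`, `l` and the phase, and the phase determines
`r` and `m` (`exp_phase_injective`).
-/

namespace HWReconstruction

/-! ### Operators induced on Fock space -/

section FockOp

variable {ι : Type} [Fintype ι]

/-- The linear form `∑ m', A m' m • x_m'` that replaces the variable `x_m`: the image of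
the creation operator `a†_m`, with creation operators encoded as polynomial variables. -/
noncomputable def modeForm (A : Matrix ι ι ℂ) (m : ι) : MvPolynomial ι ℂ :=
  ∑ m', MvPolynomial.C (A m' m) * MvPolynomial.X m'

/-- The action `x_m ↦ ∑ m', A m' m • x_m'` of a mode transformation on polynomials in the creation
operators. -/
noncomputable def modeSubst (A : Matrix ι ι ℂ) : MvPolynomial ι ℂ →ₐ[ℂ] MvPolynomial ι ℂ :=
  MvPolynomial.aeval (modeForm A)

theorem modeSubst_monomial (A : Matrix ι ι ℂ) (n : ι →₀ ℕ) :
    modeSubst A (MvPolynomial.monomial n 1) =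
      ∏ m, modeForm A m ^ n m := by
  rw [modeSubst, MvPolynomial.aeval_monomial, map_one, one_mul, Finsupp.prod_fintype _ _ (by simp)]

theorem modeSubst_comp (A B : Matrix ι ι ℂ) :
    modeSubst (A * B) = (modeSubst A).comp (modeSubst B) := by
  refine MvPolynomial.algHom_ext fun m => ?_
  simp only [modeSubst, modeForm, MvPolynomial.aeval_X, AlgHom.comp_apply, map_sum, map_mul,
    Matrix.mul_apply, Finset.sum_mul, Finset.mul_sum, MvPolynomial.aeval_C,
    MvPolynomial.algebraMap_eq]
  rw [Finset.sum_comm]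
  exact Finset.sum_congr rfl fun i _ => Finset.sum_congr rfl fun j _ => by ring

theorem modeForm_add_smul (A B : Matrix ι ι ℂ) (s : ℂ) (m : ι) :
    modeForm (A + s • B) m = modeForm A m + MvPolynomial.C s * modeForm B m := by
  simp only [modeForm, Matrix.add_apply, Matrix.smul_apply, smul_eq_mul, map_add, map_mul,
    add_mul, Finset.sum_add_distrib, Finset.mul_sum, mul_assoc]

theorem occFactorial_pos (n : ι →₀ ℕ) : 0 < occFactorial n := by
  unfold occFactorial
  exact_mod_cast Finset.prod_pos fun i _ => Nat.factorial_pos _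

theorem sqrt_occFactorial_ne_zero (n : ι →₀ ℕ) : ((Real.sqrt (occFactorial n) : ℝ) : ℂ) ≠ 0 := by
  exact_mod_cast (Real.sqrt_pos.2 (occFactorial_pos n)).ne'

theorem coeff_sumElim_rename_mul {κ : Type} (p q : MvPolynomial κ ℂ) (ν n : κ →₀ ℕ) :
    MvPolynomial.coeff (Finsupp.sumElim ν n)
      (MvPolynomial.rename Sum.inl p * MvPolynomial.rename Sum.inr q) =
    MvPolynomial.coeff ν p * MvPolynomial.coeff n q := by
  classical
  induction p using MvPolynomial.induction_on' with
  | add p₁ p₂ h₁ h₂ => simp only [map_add, add_mul, MvPolynomial.coeff_add, h₁, h₂]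
  | monomial a x =>
    induction q using MvPolynomial.induction_on' with
    | add q₁ q₂ h₁ h₂ => simp only [map_add, mul_add, MvPolynomial.coeff_add, h₁, h₂]
    | monomial b y =>
      have key : Finsupp.mapDomain Sum.inl a + Finsupp.mapDomain Sum.inr b =
          Finsupp.sumElim ν n ↔ a = ν ∧ b = n := by
        have e1 : ∀ i, (Finsupp.mapDomain Sum.inl a + Finsupp.mapDomain Sum.inr b :
            κ ⊕ κ →₀ ℕ) (Sum.inl i) = a i := fun i => by
          rw [Finsupp.add_apply, Finsupp.mapDomain_apply Sum.inl_injective,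
            Finsupp.mapDomain_of_notMem_range _ _ (by simp), add_zero]
        have e2 : ∀ i, (Finsupp.mapDomain Sum.inl a + Finsupp.mapDomain Sum.inr b :
            κ ⊕ κ →₀ ℕ) (Sum.inr i) = b i := fun i => by
          rw [Finsupp.add_apply, Finsupp.mapDomain_apply Sum.inr_injective,
            Finsupp.mapDomain_of_notMem_range _ _ (by simp), zero_add]
        refine ⟨fun h => ⟨?_, ?_⟩, fun h => ?_⟩
        · ext i
          rw [← e1, h]; simp
        · ext i
          rw [← e2, h]; simp
        · ext (i | i)
          · rw [e1, h.1]; simp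
          · rw [e2, h.2]; simp
      rw [MvPolynomial.rename_monomial, MvPolynomial.rename_monomial, MvPolynomial.monomial_mul,
        MvPolynomial.coeff_monomial, MvPolynomial.coeff_monomial, MvPolynomial.coeff_monomial]
      simp only [key]
      by_cases ha : a = ν <;> by_cases hb : b = n <;> simp [ha, hb]

variable [DecidableEq ι]

theorem Fock.sum_eq {N : ℕ} (n : Fock ι N) : ∑ i, n.1 i = N :=
  (Finset.mem_finsuppAntidiag.1 n.2).1

theorem mem_fock_iff {N : ℕ} {n : ι →₀ ℕ} :
    n ∈ Finset.finsuppAntidiag (Finset.univ : Finset ι) N ↔ ∑ i, n i = N := by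
  simp [Finset.mem_finsuppAntidiag]

theorem isHomogeneous_modeSubst_monomial (A : Matrix ι ι ℂ) {N : ℕ} (n : Fock ι N) :
    (modeSubst A (MvPolynomial.monomial n.1 1)).IsHomogeneous N := by
  rw [modeSubst_monomial]
  have h := MvPolynomial.IsHomogeneous.prod (Finset.univ : Finset ι)
    (fun m => modeForm A m ^ n.1 m) (fun m => 1 * n.1 m)
    fun m _ => (MvPolynomial.IsHomogeneous.sum _ _ _ fun m' _ => by
      simpa using (MvPolynomial.isHomogeneous_C ι (A m' m)).mul
        (MvPolynomial.isHomogeneous_X ℂ m')).pow _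
  simpa [Fock.sum_eq] using h

theorem fockOp_apply {N : ℕ} (A : Matrix ι ι ℂ) (ν n : Fock ι N) :
    fockOp N A ν n = ((Real.sqrt (occFactorial ν.1) / Real.sqrt (occFactorial n.1) : ℝ) : ℂ) *
      MvPolynomial.coeff ν.1 (modeSubst A (MvPolynomial.monomial n.1 1)) := by
  rw [modeSubst_monomial]; rfl

/-- The image of a Fock monomial is homogeneous of degree `N`, hence supported on the Fock basis. -/
theorem modeSubst_monomial_eq_sum (A : Matrix ι ι ℂ) {N : ℕ} (n : Fock ι N) :
    modeSubst A (MvPolynomial.monomial n.1 1) =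
      ∑ κ : Fock ι N, MvPolynomial.coeff κ.1 (modeSubst A (MvPolynomial.monomial n.1 1)) •
        MvPolynomial.monomial κ.1 1 := by
  rw [Finset.sum_coe_sort (Finset.finsuppAntidiag (Finset.univ : Finset ι) N) (fun κ =>
    MvPolynomial.coeff κ (modeSubst A (MvPolynomial.monomial n.1 1)) •
        MvPolynomial.monomial κ (1 : ℂ))]
  ext d
  simp only [MvPolynomial.coeff_sum, MvPolynomial.coeff_smul, MvPolynomial.coeff_monomial,
    smul_eq_mul, mul_ite, mul_one, mul_zero, Finset.sum_ite_eq']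
  split_ifs with h
  · rfl
  · refine (isHomogeneous_modeSubst_monomial A n).coeff_eq_zero fun h' => h ?_
    rwa [mem_fock_iff, ← Finsupp.degree_eq_sum]

theorem fockOp_mul (N : ℕ) (A B : Matrix ι ι ℂ) :
    fockOp N (A * B) = fockOp N A * fockOp N B := by
  ext ν n
  rw [Matrix.mul_apply, fockOp_apply, modeSubst_comp, AlgHom.comp_apply,
    modeSubst_monomial_eq_sum B n]
  simp only [map_sum, map_smul, MvPolynomial.coeff_sum, MvPolynomial.coeff_smul, Finset.mul_sum,
    smul_eq_mul]
  refine Finset.sum_congr rfl fun κ _ => ?_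
  rw [fockOp_apply, fockOp_apply]
  have := sqrt_occFactorial_ne_zero κ.1
  have := sqrt_occFactorial_ne_zero n.1
  push_cast
  field_simp

theorem fockOp_diagonal (N : ℕ) (d : ι → ℂ) :
    fockOp N (Matrix.diagonal d) = Matrix.diagonal fun n => ∏ i, d i ^ n.1 i := by
  ext ν n
  have h : modeSubst (Matrix.diagonal d) (MvPolynomial.monomial n.1 1) =
      MvPolynomial.C (∏ i, d i ^ n.1 i) * MvPolynomial.monomial n.1 1 := by
    rw [modeSubst_monomial]
    have : ∀ m, modeForm (Matrix.diagonal d) m = MvPolynomial.C (d m) * MvPolynomial.X m :=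
        fun m => by
      rw [modeForm, Finset.sum_eq_single m (fun b _ hb => by simp [Matrix.diagonal_apply_ne _ hb])
        (by simp)]
      simp
    simp_rw [this, mul_pow, Finset.prod_mul_distrib, map_prod, map_pow]
    rw [MvPolynomial.monomial_eq, Finsupp.prod_fintype _ _ (by simp)]
    simp
  rw [fockOp_apply, h, MvPolynomial.coeff_C_mul, MvPolynomial.coeff_monomial]
  by_cases hn : ν = n
  · subst hn
    have := sqrt_occFactorial_ne_zero ν.1
    push_cast
    simp [this]
  · rw [Matrix.diagonal_apply_ne _ hn, if_neg fun h => hn (Subtype.ext h.symm)]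
    simp

theorem fockOp_one (N : ℕ) : fockOp N (1 : Matrix ι ι ℂ) = 1 := by
  rw [← Matrix.diagonal_one, fockOp_diagonal]
  simp

theorem fockOp_smul (N : ℕ) (c : ℂ) (A : Matrix ι ι ℂ) :
    fockOp N (c • A) = c ^ N • fockOp N A := by
  rw [Matrix.smul_eq_diagonal_mul, fockOp_mul, fockOp_diagonal]
  simp only [Finset.prod_pow_eq_pow_sum, Fock.sum_eq]
  rw [← Matrix.smul_eq_diagonal_mul]

theorem multinomial_eq_div {N : ℕ} (n : Fock ι N) :
    (Nat.multinomial Finset.univ n.1 : ℂ) = N.factorial / (occFactorial n.1 : ℂ) := by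
  rw [eq_div_iff (by exact_mod_cast (occFactorial_pos n.1).ne')]
  have h := Nat.multinomial_spec Finset.univ n.1
  rw [Fock.sum_eq] at h
  rw [mul_comm]
  unfold occFactorial
  exact_mod_cast h

/-- The multinomial theorem, indexed by the Fock basis. -/
theorem sum_pow_eq_sum_fock {R : Type*} [CommSemiring R] (f : ι → R) (N : ℕ) :
    (∑ i, f i) ^ N = ∑ n : Fock ι N, (Nat.multinomial Finset.univ n.1 : R) * ∏ i, f i ^ n.1 i := by
  rw [Finset.sum_pow_eq_sum_piAntidiag]
  refine (Finset.sum_bij (fun (n : Fock ι N) _ => (⇑n.1 : ι → ℕ)) ?_ ?_ ?_ ?_).symm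
  · intro n _
    simp [Finset.mem_piAntidiag, Fock.sum_eq]
  · intro a _ b _ h
    exact Subtype.ext (DFunLike.coe_injective h)
  · intro g hg
    rw [Finset.mem_piAntidiag] at hg
    exact ⟨⟨Finsupp.equivFunOnFinite.symm g, mem_fock_iff.2 (by simpa using hg.1)⟩,
      Finset.mem_univ _, by simp⟩
  · intro n _
    rfl

/-- The form `(∑ A m' m x_m' y_m)^N`, with `x` and `y` the `Sum.inl` and `Sum.inr` variables,
generates the amplitudes: expand by the multinomial theorem in the modes `m` of `y`. -/
theorem coeff_generating_pow {N : ℕ} (A : Matrix ι ι ℂ) (ν n : Fock ι N) :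
    MvPolynomial.coeff (Finsupp.sumElim ν.1 n.1)
      ((∑ m, (∑ m', MvPolynomial.C (A m' m) * MvPolynomial.X (Sum.inl m')) *
        MvPolynomial.X (Sum.inr m) : MvPolynomial (ι ⊕ ι) ℂ) ^ N) =
    N.factorial / (occFactorial n.1 : ℂ) *
      MvPolynomial.coeff ν.1 (modeSubst A (MvPolynomial.monomial n.1 1)) := by
  have h : ∀ κ : Fock ι N, ((Nat.multinomial Finset.univ κ.1 : ℕ) : MvPolynomial (ι ⊕ ι) ℂ) *
      ∏ m, ((∑ m', MvPolynomial.C (A m' m) * MvPolynomial.X (Sum.inl m')) *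
        MvPolynomial.X (Sum.inr m)) ^ κ.1 m =
      MvPolynomial.C (Nat.multinomial Finset.univ κ.1 : ℂ) *
      (MvPolynomial.rename Sum.inl (modeSubst A (MvPolynomial.monomial κ.1 1)) *
        MvPolynomial.rename Sum.inr (MvPolynomial.monomial κ.1 1)) := fun κ => by
    rw [MvPolynomial.monomial_eq, Finsupp.prod_fintype _ _ (by simp), MvPolynomial.C_1, one_mul,
      show (∏ i, MvPolynomial.X i ^ κ.1 i : MvPolynomial ι ℂ) = MvPolynomial.monomial κ.1 1 by
        rw [MvPolynomial.monomial_eq, Finsupp.prod_fintype _ _ (by simp), MvPolynomial.C_1,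
          one_mul], modeSubst_monomial]
    conv_rhs => rw [MvPolynomial.monomial_eq, Finsupp.prod_fintype _ _ (by simp),
      MvPolynomial.C_1, one_mul]
    simp [modeForm, mul_pow, Finset.prod_mul_distrib]
  rw [sum_pow_eq_sum_fock, Finset.sum_congr rfl fun κ _ => h κ, MvPolynomial.coeff_sum,
    Finset.sum_eq_single n]
  · rw [MvPolynomial.coeff_C_mul, coeff_sumElim_rename_mul, MvPolynomial.coeff_monomial, if_pos rfl,
      mul_one, multinomial_eq_div]
  · intro κ _ hκ
    rw [MvPolynomial.coeff_C_mul, coeff_sumElim_rename_mul, MvPolynomial.coeff_monomial,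
      if_neg fun h => hκ (Subtype.ext h), mul_zero, mul_zero]
  · simp

/-- The same form expanded in the modes `m'` of `x`: exchanging `x` and `y` transposes `A`. -/
theorem coeff_generating_pow_transpose {N : ℕ} (A : Matrix ι ι ℂ) (ν n : Fock ι N) :
    MvPolynomial.coeff (Finsupp.sumElim ν.1 n.1)
      ((∑ m', (∑ m, MvPolynomial.C (A m' m) * MvPolynomial.X (Sum.inr m)) *
        MvPolynomial.X (Sum.inl m') : MvPolynomial (ι ⊕ ι) ℂ) ^ N) =
    N.factorial / (occFactorial ν.1 : ℂ) *
      MvPolynomial.coeff n.1 (modeSubst Aᵀ (MvPolynomial.monomial ν.1 1)) := by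
  rw [← coeff_generating_pow Aᵀ n ν]
  have hs : Finsupp.sumElim ν.1 n.1 =
      Finsupp.mapDomain Sum.swap (Finsupp.sumElim n.1 ν.1) := by
    ext (i | i)
    · rw [show (Sum.inl i : ι ⊕ ι) = Sum.swap (Sum.inr i) from rfl,
        Finsupp.mapDomain_apply Sum.swap_leftInverse.injective]; simp
    · rw [show (Sum.inr i : ι ⊕ ι) = Sum.swap (Sum.inl i) from rfl,
        Finsupp.mapDomain_apply Sum.swap_leftInverse.injective]; simp
  rw [hs, ← MvPolynomial.coeff_rename_mapDomain Sum.swap Sum.swap_leftInverse.injective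
    _ (Finsupp.sumElim n.1 ν.1)]
  simp

theorem fockOp_transpose (N : ℕ) (A : Matrix ι ι ℂ) : fockOp N Aᵀ = (fockOp N A)ᵀ := by
  ext n ν
  rw [Matrix.transpose_apply, fockOp_apply, fockOp_apply]
  have h : N.factorial / (occFactorial n.1 : ℂ) *
      MvPolynomial.coeff ν.1 (modeSubst A (MvPolynomial.monomial n.1 1)) =
    N.factorial / (occFactorial ν.1 : ℂ) *
      MvPolynomial.coeff n.1 (modeSubst Aᵀ (MvPolynomial.monomial ν.1 1)) := by
    rw [← coeff_generating_pow A ν n, ← coeff_generating_pow_transpose A ν n]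
    refine congrArg (fun p => MvPolynomial.coeff _ (p ^ N)) ?_
    simp only [Finset.sum_mul]
    rw [Finset.sum_comm]
    exact Finset.sum_congr rfl fun i _ => Finset.sum_congr rfl fun j _ => by ring
  have e : ∀ κ : Fock ι N, (occFactorial κ.1 : ℂ) =
      ((Real.sqrt (occFactorial κ.1) : ℝ) : ℂ) * ((Real.sqrt (occFactorial κ.1) : ℝ) : ℂ) :=
    fun κ => by exact_mod_cast (Real.mul_self_sqrt (occFactorial_pos κ.1).le).symm
  rw [e, e] at h
  have h1 := sqrt_occFactorial_ne_zero ν.1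
  have h2 := sqrt_occFactorial_ne_zero n.1
  have h3 : (N.factorial : ℂ) ≠ 0 := by exact_mod_cast N.factorial_ne_zero
  push_cast
  field_simp at h ⊢
  linear_combination -h

theorem fockOp_map_star (N : ℕ) (A : Matrix ι ι ℂ) :
    fockOp N (A.map star) = (fockOp N A).map star := by
  ext ν n
  rw [Matrix.map_apply, fockOp_apply, fockOp_apply, modeSubst_monomial, modeSubst_monomial]
  have h : ∏ m, modeForm (A.map star) m ^ n.1 m = MvPolynomial.map (starRingEnd ℂ)
        (∏ m, modeForm A m ^ n.1 m) := by
    simp [modeForm]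
  rw [h, MvPolynomial.coeff_map]
  simp

theorem fockOp_conjTranspose (N : ℕ) (A : Matrix ι ι ℂ) : fockOp N Aᴴ = (fockOp N A)ᴴ := by
  rw [Matrix.conjTranspose, fockOp_map_star, fockOp_transpose]; rfl

/-- Entrywise form of `exists_fockOp_add_smul`: the product defining an amplitude is taken over
`ℂ[x][s]`, where every factor has degree at most one in `s`. -/
theorem exists_fockOp_add_smul_apply (A B : Matrix ι ι ℂ) {N : ℕ} (ν n : Fock ι N) :
    ∃ Q : ℕ → ℂ, Q 0 = fockOp N A ν n ∧ Q N = fockOp N B ν n ∧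
      ∀ s : ℂ, fockOp N (A + s • B) ν n = ∑ j ∈ Finset.range (N + 1), Q j * s ^ j := by
  let F : ι → Polynomial (MvPolynomial ι ℂ) := fun m =>
    Polynomial.C (modeForm B m) * Polynomial.X + Polynomial.C (modeForm A m)
  let P := ∏ m, F m ^ n.1 m
  have hL : ∀ (s : ℂ) m, modeForm (A + s • B) m = (F m).eval (MvPolynomial.C s) := fun s m => by
    simp only [F, Polynomial.eval_add, Polynomial.eval_mul, Polynomial.eval_C,
      Polynomial.eval_X, modeForm_add_smul]
    rw [add_comm, mul_comm]
  have hF : ∀ m, (F m).natDegree ≤ 1 := fun m => Polynomial.natDegree_linear_le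
  have hdeg : P.natDegree ≤ N := by
    refine (Polynomial.natDegree_prod_le _ _).trans ?_
    refine le_of_le_of_eq ?_ (Fock.sum_eq n)
    refine Finset.sum_le_sum fun m _ => ?_
    simpa using Polynomial.natDegree_pow_le_of_le (n.1 m) (hF m)
  have hP : ∀ s : ℂ, modeSubst (A + s • B) (MvPolynomial.monomial n.1 1) =
      ∑ j ∈ Finset.range (N + 1), P.coeff j * MvPolynomial.C (s ^ j) := fun s => by
    rw [modeSubst_monomial]
    simp only [hL, ← Polynomial.eval_pow]
    rw [← Polynomial.eval_prod, Polynomial.eval_eq_sum_range' (Nat.lt_succ_of_le hdeg)]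
    simp
  have hcoeffN : ∀ s : Finset ι, (∏ m ∈ s, F m ^ n.1 m).coeff (∑ m ∈ s, n.1 m) =
      ∏ m ∈ s, modeForm B m ^ n.1 m := fun s => by
    induction s using Finset.induction_on with
    | empty => simp
    | insert a s ha ih =>
      rw [Finset.prod_insert ha, Finset.sum_insert ha, Finset.prod_insert ha,
        Polynomial.coeff_mul_add_eq_of_natDegree_le, ih]
      · congr 1
        have := Polynomial.coeff_pow_of_natDegree_le (m := n.1 a) (hF a)
        rw [mul_one] at this
        rw [this]
        simp [F]
      · simpa using Polynomial.natDegree_pow_le_of_le (n.1 a) (hF a)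
      · refine (Polynomial.natDegree_prod_le _ _).trans (Finset.sum_le_sum fun m _ => ?_)
        simpa using Polynomial.natDegree_pow_le_of_le (n.1 m) (hF m)
  refine ⟨fun j => ((Real.sqrt (occFactorial ν.1) / Real.sqrt (occFactorial n.1) : ℝ) : ℂ) *
    MvPolynomial.coeff ν.1 (P.coeff j), ?_, ?_, fun s => ?_⟩
  · rw [fockOp_apply, modeSubst_monomial]
    simp [P, F, Polynomial.coeff_zero_eq_eval_zero, Polynomial.eval_prod]
  · rw [fockOp_apply, modeSubst_monomial]
    have := hcoeffN Finset.univ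
    rw [Fock.sum_eq] at this
    simp only [P, this]
  · rw [fockOp_apply, hP, MvPolynomial.coeff_sum, Finset.mul_sum]
    refine Finset.sum_congr rfl fun j _ => ?_
    rw [mul_comm (P.coeff j), MvPolynomial.coeff_C_mul]
    ring

/-- The operator induced by `A + s • B` is a polynomial in `s` of degree at most `N`, whose extremal
coefficients are the operators induced by `A` and `B`. -/
theorem exists_fockOp_add_smul (N : ℕ) (A B : Matrix ι ι ℂ) :
    ∃ Q : ℕ → Matrix (Fock ι N) (Fock ι N) ℂ, Q 0 = fockOp N A ∧ Q N = fockOp N B ∧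
      ∀ s : ℂ, fockOp N (A + s • B) = ∑ j ∈ Finset.range (N + 1), s ^ j • Q j := by
  choose Q h0 hN h using fun ν n : Fock ι N => exists_fockOp_add_smul_apply A B ν n
  refine ⟨fun j => Matrix.of fun ν n => Q ν n j, Matrix.ext h0, Matrix.ext hN, fun s => ?_⟩
  ext ν n
  rw [h, Matrix.sum_apply]
  exact Finset.sum_congr rfl fun j _ => by simp [mul_comm]

end FockOp

/-! ### The DQC1 expectation value -/

section DQC1

variable {ι : Type} [Fintype ι] [DecidableEq ι] {N : ℕ}

/-- With vacuum in arm `B` at input and output, only the `A`-`A` block of the mode matrix acts. -/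
theorem injectA_conjTranspose_mul_mul (B : Matrix (ι ⊕ ι) (ι ⊕ ι) ℂ) :
    (injectA ι N)ᴴ * fockOp N B * injectA ι N = fockOp N B.toBlocks₁₁ := by
  let e : Fock ι N → Fock (ι ⊕ ι) N := fun n => ⟨Finsupp.sumElim n.1 0, by
    rw [mem_fock_iff]; simpa using n.sum_eq⟩
  have he : ∀ x n, injectA ι N x n = if x = e n then 1 else 0 := fun x n => by
    rw [injectA, Matrix.of_apply]
    refine if_congr ⟨fun h => Subtype.ext ?_, fun h => ?_⟩ rfl rfl
    · ext (i | i)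
      · simpa [e] using h.1 i
      · simpa [e] using h.2 i
    · subst h; simp [e]
  have hfac : ∀ n, occFactorial (e n).1 = occFactorial n.1 := fun n => by
    simp [occFactorial, e]
  ext ν n
  have h1 : ((injectA ι N)ᴴ * fockOp N B * injectA ι N) ν n = fockOp N B (e ν) (e n) := by
    simp [Matrix.mul_apply, he, Matrix.conjTranspose_apply]
  rw [h1, fockOp_apply, fockOp_apply, hfac, hfac]
  congr 1
  -- setting the variables of arm `B` to zero keeps the coefficients of `e ν`
  let π : MvPolynomial (ι ⊕ ι) ℂ →ₐ[ℂ] MvPolynomial ι ℂ :=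
    MvPolynomial.aeval (Sum.elim MvPolynomial.X 0)
  have hπ : ∀ p, MvPolynomial.coeff ν.1 (π p) = MvPolynomial.coeff (e ν).1 p := fun p => by
    induction p using MvPolynomial.induction_on' with
    | add p q hp hq => rw [map_add, MvPolynomial.coeff_add, MvPolynomial.coeff_add, hp, hq]
    | monomial d a =>
      rw [MvPolynomial.aeval_monomial, Finsupp.prod_fintype _ _ (by simp), Fintype.prod_sum_type]
      simp only [Sum.elim_inl, Sum.elim_inr, Pi.zero_apply, MvPolynomial.algebraMap_eq]
      rw [MvPolynomial.coeff_monomial]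
      by_cases hd : ∀ i, d (Sum.inr i) = 0
      · have : (∏ i, (MvPolynomial.X i : MvPolynomial ι ℂ) ^ d (Sum.inl i)) =
            MvPolynomial.monomial (Finsupp.equivFunOnFinite.symm fun i => d (Sum.inl i)) 1 := by
          rw [MvPolynomial.monomial_eq, Finsupp.prod_fintype _ _ (by simp)]
          simp
        rw [this, Finset.prod_eq_one fun i _ => by simp [hd i], mul_one,
          MvPolynomial.coeff_C_mul, MvPolynomial.coeff_monomial, mul_ite, mul_one, mul_zero]
        refine if_congr ⟨fun h => ?_, fun h => ?_⟩ rfl rfl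
        · ext (i | i)
          · simpa [e] using DFunLike.congr_fun h i
          · simpa [e] using hd i
        · ext i
          simpa [e] using DFunLike.congr_fun h (Sum.inl i)
      · rw [if_neg fun h => hd fun i => by simp [h, e]]
        push Not at hd
        obtain ⟨i, hi⟩ := hd
        have h0 : ∏ j, (0 : MvPolynomial ι ℂ) ^ d (Sum.inr j) = 0 :=
          Finset.prod_eq_zero (Finset.mem_univ i) (zero_pow hi)
        rw [h0, mul_zero, mul_zero, MvPolynomial.coeff_zero]
  rw [← hπ, modeSubst_monomial, modeSubst_monomial, map_prod, Fintype.prod_sum_type]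
  simp [e, modeForm, π, Matrix.toBlocks₁₁]

omit [Fintype ι] in
theorem beamSplitter_conjTranspose : (beamSplitter ι)ᴴ = beamSplitter ι := by
  simp [beamSplitter, Matrix.conjTranspose_smul, Matrix.fromBlocks_conjTranspose]

theorem beamSplitter_mul (V : Matrix ι ι ℂ) :
    (beamSplitter ι)ᴴ * Matrix.fromBlocks 1 0 0 V * beamSplitter ι =
      Matrix.fromBlocks ((1 / 2 : ℂ) • (1 + V)) ((1 / 2 : ℂ) • (1 - V))
        ((1 / 2 : ℂ) • (1 - V)) ((1 / 2 : ℂ) • (1 + V)) := by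
  have h2 : ((1 / Real.sqrt 2 : ℝ) : ℂ) * ((1 / Real.sqrt 2 : ℝ) : ℂ) = 1 / 2 := by
    rw [← Complex.ofReal_mul, ← mul_div_mul_comm, Real.mul_self_sqrt (by norm_num)]
    norm_num
  rw [beamSplitter_conjTranspose, beamSplitter, Matrix.smul_mul, Matrix.smul_mul, Matrix.mul_smul,
    smul_smul, h2, Matrix.fromBlocks_multiply, Matrix.fromBlocks_multiply,
    Matrix.fromBlocks_smul]
  congr 1 <;> simp [sub_eq_add_neg]

theorem dqc1Interferometer_eq (W V : Matrix ι ι ℂ) :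
    dqc1Interferometer W V =
      Matrix.fromBlocks ((1 / 2 : ℂ) • (Wᴴ * (1 + V) * W)) ((1 / 2 : ℂ) • (Wᴴ * (1 - V)))
        ((1 / 2 : ℂ) • ((1 - V) * W)) ((1 / 2 : ℂ) • (1 + V)) := by
  rw [dqc1Interferometer, Matrix.mul_assoc (Matrix.fromBlocks Wᴴ 0 0 1),
    Matrix.mul_assoc (Matrix.fromBlocks Wᴴ 0 0 1), beamSplitter_mul, Matrix.fromBlocks_multiply,
    Matrix.fromBlocks_multiply]
  simp [-smul_add]

/-- The sign flip of arm `B`, which induces the parity `(-1)^N_B`, pulled back through the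
interferometer and compressed to arm `A`. The contributions of the two arms are
`W† (1 ± V)† (1 ± V) W / 4`; their difference leaves the Hermitian part of `W† V W`. -/
theorem interferometer_conjTranspose_mul_mul {W V : Matrix ι ι ℂ} (hW : Wᴴ * W = 1)
    (hV : Vᴴ * V = 1) :
    ((dqc1Interferometer W V)ᴴ * Matrix.diagonal (Sum.elim (fun _ => 1) fun _ => -1) *
      dqc1Interferometer W V).toBlocks₁₁ =
      (1 / 2 : ℂ) • (Wᴴ * V * W + (Wᴴ * V * W)ᴴ) := by
  have hW' : W * Wᴴ = 1 := mul_eq_one_comm.1 hW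
  have hS : Matrix.diagonal (Sum.elim (fun _ => 1) fun _ => -1) =
      (Matrix.fromBlocks 1 0 0 (-1) : Matrix (ι ⊕ ι) (ι ⊕ ι) ℂ) := by
    rw [← Matrix.diagonal_one, ← Matrix.fromBlocks_diagonal]
    congr 1
    ext i j; simp [Matrix.diagonal, Matrix.neg_apply, apply_ite]
  rw [hS, dqc1Interferometer_eq, Matrix.fromBlocks_conjTranspose, Matrix.fromBlocks_multiply,
    Matrix.fromBlocks_multiply, Matrix.toBlocks_fromBlocks₁₁]
  simp only [Matrix.conjTranspose_smul, Matrix.conjTranspose_mul, Matrix.conjTranspose_add,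
    Matrix.conjTranspose_sub, Matrix.conjTranspose_one, Matrix.conjTranspose_conjTranspose,
    Matrix.mul_zero, Matrix.mul_one, Matrix.mul_neg, add_zero, zero_add, Matrix.smul_mul,
    Matrix.mul_smul, smul_smul, Matrix.neg_mul]
  have e1 : Wᴴ * ((1 + Vᴴ) * W) * (Wᴴ * (1 + V) * W) =
      Wᴴ * W + Wᴴ * V * W + Wᴴ * Vᴴ * W + Wᴴ * W := by
    calc _ = Wᴴ * ((1 + Vᴴ) * (W * Wᴴ) * (1 + V)) * W := by noncomm_ring
      _ = Wᴴ * (1 + V + Vᴴ + Vᴴ * V) * W := by rw [hW']; noncomm_ring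
      _ = _ := by rw [hV]; noncomm_ring
  have e2 : Wᴴ * (1 - Vᴴ) * ((1 - V) * W) =
      Wᴴ * W - Wᴴ * V * W - Wᴴ * Vᴴ * W + Wᴴ * W := by
    calc _ = Wᴴ * (1 - V - Vᴴ + Vᴴ * V) * W := by noncomm_ring
      _ = _ := by rw [hV]; noncomm_ring
  rw [e1, e2]
  simp only [Matrix.mul_assoc]
  ext i j
  simp [Matrix.add_apply]
  ring

theorem dqc1Interferometer_unitary {W V : Matrix ι ι ℂ} (hW : Wᴴ * W = 1) (hV : Vᴴ * V = 1) :
    (dqc1Interferometer W V)ᴴ * dqc1Interferometer W V = 1 := by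
  have hW' : W * Wᴴ = 1 := mul_eq_one_comm.1 hW
  have hB : beamSplitter ι * (beamSplitter ι)ᴴ = 1 := by
    apply mul_eq_one_comm.1
    have := beamSplitter_mul (1 : Matrix ι ι ℂ)
    rw [Matrix.fromBlocks_one, Matrix.mul_one] at this
    rw [this, ← Matrix.fromBlocks_one]
    congr 1
    · rw [← two_smul ℂ, smul_smul]; norm_num
    · simp
    · simp
    · rw [← two_smul ℂ, smul_smul]; norm_num
  have h : ∀ {κ : Type} [Fintype κ] [DecidableEq κ] {A B : Matrix κ κ ℂ}, Aᴴ * A = 1 →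
      Bᴴ * B = 1 → (A * B)ᴴ * (A * B) = 1 := fun {κ _ _ A B} hA hB => by
    rw [Matrix.conjTranspose_mul, Matrix.mul_assoc, ← Matrix.mul_assoc Aᴴ, hA, Matrix.one_mul, hB]
  unfold dqc1Interferometer
  refine h (h (h (h ?_ ?_) ?_) ?_) ?_
  · simp [Matrix.fromBlocks_conjTranspose, Matrix.fromBlocks_multiply, hW']
  · rwa [Matrix.conjTranspose_conjTranspose]
  · simp [Matrix.fromBlocks_conjTranspose, Matrix.fromBlocks_multiply, hV]
  · rw [beamSplitter_conjTranspose] at hB ⊢; exact hB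
  · simp [Matrix.fromBlocks_conjTranspose, Matrix.fromBlocks_multiply, hW]

/-- Moving the interferometer from the output state to the observable. -/
theorem trace_dqc1Output_mul (ρ : Matrix (Fock ι N) (Fock ι N) ℂ) (W V : Matrix ι ι ℂ)
    (S : Matrix (ι ⊕ ι) (ι ⊕ ι) ℂ) :
    (fockOp N S * dqc1Output ρ W V).trace = expect ρ
      ((dqc1Interferometer W V)ᴴ * S * dqc1Interferometer W V).toBlocks₁₁ := by
  rw [expect, ← injectA_conjTranspose_mul_mul, fockOp_mul, fockOp_mul, fockOp_conjTranspose,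
    dqc1Output]
  simp only [← Matrix.mul_assoc]
  rw [Matrix.trace_mul_comm]
  simp only [← Matrix.mul_assoc]
  rw [Matrix.trace_mul_comm]
  simp only [← Matrix.mul_assoc]
  rw [Matrix.trace_mul_comm]
  simp only [← Matrix.mul_assoc]

/-- The generating function of the photon number in arm `B`; at `c = 1` it is the total probability,
at `c = -1` the mean parity. -/
theorem sum_mul_detectProb (ρ : Matrix (Fock ι N) (Fock ι N) ℂ) (W V : Matrix ι ι ℂ) (c : ℝ) :
    ∑ j ∈ Finset.range (N + 1), c ^ j * detectProb ρ W V (N - j) j =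
      ((fockOp N (Matrix.diagonal (Sum.elim (fun _ => 1) fun _ => (c : ℂ))) *
        dqc1Output ρ W V).trace).re := by
  simp only [detectProb, Finset.mul_sum]
  rw [Finset.sum_comm, fockOp_diagonal, Matrix.trace, Complex.re_sum]
  refine Finset.sum_congr rfl fun x _ => ?_
  have hx := x.sum_eq
  rw [Fintype.sum_sum_type] at hx
  rw [Finset.sum_eq_single (∑ i, x.1 (Sum.inr i))]
  · rw [if_pos ⟨by omega, rfl⟩, Matrix.diag_apply, Matrix.diagonal_mul, Fintype.prod_sum_type]
    simp only [Sum.elim_inl, one_pow, Finset.prod_const_one, Sum.elim_inr, one_mul,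
      Finset.prod_pow_eq_pow_sum]
    rw [← Complex.ofReal_pow, Complex.re_ofReal_mul]
  · intro j _ hj
    rw [if_neg fun h => hj h.2.symm, mul_zero]
  · intro h
    exact absurd (Finset.mem_range.2 (by omega)) h

/-- The measured value is the expectation value of the operator induced by the Hermitian part of
`W† V W`. -/
theorem dqc1Z_eq {ρ : Matrix (Fock ι N) (Fock ι N) ℂ} (hρ : ρ.trace = 1) {W V : Matrix ι ι ℂ}
    (hW : Wᴴ * W = 1) (hV : Vᴴ * V = 1) :
    dqc1Z ρ W V = (expect ρ ((1 / 2 : ℂ) • (Wᴴ * V * W + (Wᴴ * V * W)ᴴ))).re := by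
  have h1 : ∑ j ∈ Finset.range (N + 1), detectProb ρ W V (N - j) j = 1 := by
    have h := sum_mul_detectProb ρ W V 1
    simp only [one_pow, one_mul] at h
    rw [h, trace_dqc1Output_mul]
    have e : Matrix.diagonal (Sum.elim (fun _ => 1) fun _ => ((1 : ℝ) : ℂ)) =
        (1 : Matrix (ι ⊕ ι) (ι ⊕ ι) ℂ) := by
      rw [← Matrix.diagonal_one]
      congr 1
      ext (i | i) <;> simp
    rw [e, Matrix.mul_one, dqc1Interferometer_unitary hW hV, ← Matrix.fromBlocks_one,
      Matrix.toBlocks_fromBlocks₁₁, expect, fockOp_one, Matrix.mul_one, hρ, Complex.one_re]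
  unfold dqc1Z condProb
  simp only [h1, div_one]
  rw [sum_mul_detectProb, trace_dqc1Output_mul, ← interferometer_conjTranspose_mul_mul hW hV]
  simp

end DQC1

/-! ### Heisenberg-Weyl operators and the phase average -/

/-- For prime `M > N` only the extremal terms survive the phase average; for `M = 2` each of them
is met by both frequencies of the cosine, which is the case `δ = 1`. -/
theorem sum_extremal {M N : ℕ} (hM : M.Prime) (hN : 0 < N) (hNM : N < M) {k : ℕ} (hk : 1 ≤ k)
    (hkM : k < M)
    (a : ℕ → ℂ) :
    (2 : ℂ) ^ (-(if M ∣ 2 * k * N then 1 else 0 : ℤ)) * ∑ j ∈ Finset.range (N + 1), a j *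
      ((if M ∣ 2 * k * (N - j) then 1 else 0) + if M ∣ 2 * k * j then 1 else 0) = a 0 + a N := by
  have hkd : ¬ M ∣ k := Nat.not_dvd_of_pos_of_lt hk hkM
  by_cases h2 : M = 2
  · have hN1 : N = 1 := by omega
    subst hN1
    have e1 : M ∣ 2 * k * 1 := by rw [h2]; exact ⟨k, by ring⟩
    have e2 : M ∣ 2 * k := by simpa using e1
    simp [Finset.sum_range_succ, e2]
    ring
  · have h2d : ∀ t, t ≤ N → (M ∣ 2 * k * t ↔ t = 0) := fun t ht => by
      rw [hM.dvd_mul, hM.dvd_mul, Nat.prime_dvd_prime_iff_eq hM Nat.prime_two]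
      refine ⟨fun h => ?_, fun h => Or.inr (h ▸ dvd_zero _)⟩
      rcases h with (h | h) | h
      · exact absurd h h2
      · exact absurd h hkd
      · exact Nat.eq_zero_of_dvd_of_lt h (by omega)
    rw [if_neg (by rw [h2d N le_rfl]; omega), neg_zero, zpow_zero, one_mul]
    have h : ∀ j ∈ Finset.range (N + 1), a j *
        ((if M ∣ 2 * k * (N - j) then 1 else 0) + if M ∣ 2 * k * j then 1 else 0) =
        (if j = N then a j else 0) + if j = 0 then a j else 0 := fun j hj => by
      rw [Finset.mem_range] at hj
      rw [if_congr (h2d _ (Nat.sub_le N j)) rfl rfl, if_congr (h2d j (by omega)) rfl rfl,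
        if_congr (show N - j = 0 ↔ j = N by omega) rfl rfl]
      split_ifs <;> ring
    rw [Finset.sum_congr rfl h, Finset.sum_add_distrib, Finset.sum_ite_eq', Finset.sum_ite_eq']
    simp [add_comm]

section HW

variable {M : ℕ} [NeZero M] {N : ℕ}

theorem stdAddChar_natCast (n : ℕ) : ZMod.stdAddChar (n : ZMod M) =
    Complex.exp (2 * Real.pi * Complex.I * n / M) := by
  simpa using ZMod.stdAddChar_coe (N := M) n

theorem omega_pow (n : ℕ) : omega M ^ n = ZMod.stdAddChar (n : ZMod M) := by
  rw [stdAddChar_natCast, omega, ← Complex.exp_nat_mul]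
  congr 1
  ring

theorem star_stdAddChar (a : ZMod M) : star (ZMod.stdAddChar a) = ZMod.stdAddChar (-a) := by
  rw [AddChar.map_neg_eq_conj]; rfl

theorem sum_range_stdAddChar (a : ZMod M) :
    ∑ m ∈ Finset.range M, ZMod.stdAddChar ((m : ZMod M) * a) = if a = 0 then (M : ℂ) else 0 := by
  have h := AddChar.sum_mulShift a (ZMod.isPrimitive_stdAddChar M)
  rw [ZMod.card] at h
  rw [show (if a = 0 then (M : ℂ) else 0) = ((if a = 0 then M else 0 : ℕ) : ℂ) by split_ifs <;> simp,
    ← h]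
  refine Finset.sum_bij (fun m _ => (m : ZMod M)) (fun _ _ => Finset.mem_univ _) ?_ ?_
    fun _ _ => rfl
  · intro a ha b hb hab
    rw [Finset.mem_range] at ha hb
    rwa [ZMod.natCast_eq_natCast_iff', Nat.mod_eq_of_lt ha, Nat.mod_eq_of_lt hb] at hab
  · intro b _
    exact ⟨b.val, Finset.mem_range.2 b.val_lt, by simp⟩

theorem modeX_pow (k : ℕ) :
    modeX M ^ k = Matrix.of fun m' m : ZMod M => if m' = m + k then 1 else 0 := by
  induction k with
  | zero => ext i j; simp [Matrix.one_apply]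
  | succ k ih =>
    rw [pow_succ, ih]
    ext i j
    rw [Matrix.mul_apply, Finset.sum_eq_single (j + 1)]
    · simp [modeX, add_comm, add_left_comm]
    · intro b _ hb
      simp [modeX, hb]
    · simp

theorem modeZ_pow (l : ℕ) :
    modeZ M ^ l = Matrix.diagonal fun m : ZMod M => ZMod.stdAddChar ((l : ZMod M) * m) := by
  rw [modeZ, Matrix.diagonal_pow]
  congr 1
  ext m
  rw [Pi.pow_apply, ← pow_mul, omega_pow]
  simp [mul_comm]

theorem modeHW_apply (k l : ℕ) (a b : ZMod M) :
    modeHW M k l a b = if a = b + k then ZMod.stdAddChar ((l : ZMod M) * b) else 0 := by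
  rw [modeHW, modeX_pow, modeZ_pow, Matrix.mul_diagonal]
  simp

theorem modeX_unitary : (modeX M)ᴴ * modeX M = 1 := by
  ext i j
  simp only [Matrix.mul_apply, Matrix.conjTranspose_apply, modeX, Matrix.of_apply, mul_ite,
    mul_one, mul_zero, Finset.sum_ite_eq', Finset.mem_univ, if_true, Matrix.one_apply]
  simp [eq_comm]

theorem modeZ_unitary : (modeZ M)ᴴ * modeZ M = 1 := by
  have h : modeZ M = Matrix.diagonal fun m : ZMod M => ZMod.stdAddChar m := by
    simpa using modeZ_pow (M := M) 1
  rw [h, Matrix.diagonal_conjTranspose, Matrix.diagonal_mul_diagonal, ← Matrix.diagonal_one]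
  congr 1
  ext m
  rw [Pi.star_apply, star_stdAddChar, ← AddChar.map_add_eq_mul]
  simp

theorem modeHW_unitary (k l : ℕ) : (modeHW M k l)ᴴ * modeHW M k l = 1 := by
  have hX : modeX M ∈ Matrix.unitaryGroup (ZMod M) ℂ :=
    Matrix.mem_unitaryGroup_iff'.2 modeX_unitary
  have hZ : modeZ M ∈ Matrix.unitaryGroup (ZMod M) ℂ :=
    Matrix.mem_unitaryGroup_iff'.2 modeZ_unitary
  exact Matrix.mem_unitaryGroup_iff'.1 (mul_mem (pow_mem hX k) (pow_mem hZ l))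

/-- The discrete Fourier transform is a generalized Hadamard transform: its columns are the
eigenvectors of the cyclic shift. -/
theorem exists_isGenHadamard : ∃ H : Matrix (ZMod M) (ZMod M) ℂ, IsGenHadamard H 1 0 := by
  have hM : ((Real.sqrt M : ℝ) : ℂ) * ((Real.sqrt M : ℝ) : ℂ) = M := by
    exact_mod_cast Real.mul_self_sqrt (Nat.cast_nonneg M)
  have hM0 : (M : ℂ) ≠ 0 := Nat.cast_ne_zero.2 (NeZero.ne M)
  -- the unnormalized Fourier matrix
  let F : Matrix (ZMod M) (ZMod M) ℂ := Matrix.of fun m j => ZMod.stdAddChar (-(m * j))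
  have hF : F * Fᴴ = (M : ℂ) • 1 := by
    ext i j
    have h := AddChar.sum_mulShift (j - i) (ZMod.isPrimitive_stdAddChar M)
    rw [ZMod.card] at h
    simp only [Matrix.mul_apply, Matrix.conjTranspose_apply, F, Matrix.of_apply, star_stdAddChar,
      ← AddChar.map_add_eq_mul]
    rw [Matrix.smul_apply, Matrix.one_apply]
    convert h using 1
    · exact Finset.sum_congr rfl fun x _ => by congr 1; ring
    · by_cases hij : i = j
      · simp [hij]
      · rw [if_neg hij, if_neg fun h => hij (sub_eq_zero.1 h).symm]; simp
  have hXF : modeX M * F = F * modeZ M := by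
    have hZ : modeZ M = Matrix.diagonal fun m : ZMod M => ZMod.stdAddChar m := by
      simpa using modeZ_pow (M := M) 1
    ext i j
    rw [hZ, Matrix.mul_diagonal, Matrix.mul_apply, Finset.sum_eq_single (i - 1)]
    · simp only [modeX, F, Matrix.of_apply, sub_add_cancel, if_true, one_mul,
        ← AddChar.map_add_eq_mul]
      congr 1; ring
    · intro b _ hb
      simp only [modeX, Matrix.of_apply]
      rw [if_neg fun h => hb (by rw [h]; ring), zero_mul]
    · simp
  have hs : star (((Real.sqrt M : ℝ) : ℂ)⁻¹) * ((Real.sqrt M : ℝ) : ℂ)⁻¹ = (M : ℂ)⁻¹ := by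
    rw [← hM, mul_inv]
    simp
  have hU : (((Real.sqrt M : ℝ) : ℂ)⁻¹ • F) * (((Real.sqrt M : ℝ) : ℂ)⁻¹ • F)ᴴ = 1 := by
    rw [Matrix.conjTranspose_smul, Matrix.smul_mul, Matrix.mul_smul, smul_smul, hF, smul_smul,
      mul_comm (_⁻¹) (star _), hs, inv_mul_cancel₀ hM0, one_smul]
  refine ⟨((Real.sqrt M : ℝ) : ℂ)⁻¹ • F, Matrix.mem_unitaryGroup_iff.2 hU, ?_⟩
  rw [modeHW, pow_one, pow_zero, Matrix.mul_one, Matrix.smul_mul, ← hXF, ← Matrix.mul_smul,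
    Matrix.mul_assoc, hU, Matrix.mul_one]

/-- `H_{1,0}` diagonalizes `X`, so it turns `Λ_{l,0} = X^l` into `Λ_{0,l} = Z^l`. -/
theorem IsGenHadamard.conjTranspose_mul_modeHW_mul {H : Matrix (ZMod M) (ZMod M) ℂ}
    (hH : IsGenHadamard H 1 0) (l : ℕ) : Hᴴ * modeHW M l 0 * H = modeHW M 0 l := by
  have h1 : Hᴴ * H = 1 := Matrix.mem_unitaryGroup_iff'.1 hH.1
  have hX : modeX M = H * modeZ M * Hᴴ := by simpa [modeHW] using hH.2
  have h : modeX M ^ l = H * modeZ M ^ l * Hᴴ := by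
    induction l with
    | zero => simpa using (mul_eq_one_comm.1 h1).symm
    | succ l ih =>
      rw [pow_succ, ih, hX]
      calc _ = H * modeZ M ^ l * (Hᴴ * H) * modeZ M * Hᴴ := by simp only [Matrix.mul_assoc]
        _ = _ := by rw [h1, Matrix.mul_one, pow_succ]; simp only [Matrix.mul_assoc]
  rw [modeHW, modeHW, pow_zero, pow_zero, Matrix.mul_one, Matrix.one_mul, h]
  calc _ = (Hᴴ * H) * modeZ M ^ l * (Hᴴ * H) := by simp only [Matrix.mul_assoc]
    _ = _ := by rw [h1, Matrix.mul_one, Matrix.one_mul]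

theorem expect_conjTranspose {ι : Type} [Fintype ι] [DecidableEq ι]
    {ρ : Matrix (Fock ι N) (Fock ι N) ℂ} (hρ : ρ.IsHermitian)
    (A : Matrix ι ι ℂ) : expect ρ Aᴴ = star (expect ρ A) := by
  rw [expect, expect, fockOp_conjTranspose, ← Matrix.trace_conjTranspose,
    Matrix.conjTranspose_mul, hρ.eq, Matrix.trace_mul_comm]

/-- The phase average of the `j`-th term: the frequencies `±kN` of the cosine shift `k(N - 2j)` to
`2k(N - j)` and `-2kj`, and the sum over `m` tests whether these vanish modulo `M`. -/
theorem sum_cos_mul_phase {k j : ℕ} (hj : j ≤ N) {e : ℂ} :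
    ∑ m ∈ Finset.range M, ((Real.cos (2 * Real.pi / M * k * m * N) : ℝ) : ℂ) *
      ((e * ZMod.stdAddChar ((k * m : ℕ) : ZMod M)) ^ N *
        ((e * ZMod.stdAddChar ((k * m : ℕ) : ZMod M))⁻¹ ^ 2) ^ j) =
    e ^ N * (e⁻¹ ^ 2) ^ j * (M / 2 * ((if M ∣ 2 * k * (N - j) then 1 else 0) +
      if M ∣ 2 * k * j then 1 else 0)) := by
  have hcos : ∀ m : ℕ, ((Real.cos (2 * Real.pi / M * k * m * N) : ℝ) : ℂ) =
      (ZMod.stdAddChar (m * (k * N) : ZMod M) + ZMod.stdAddChar (m * -(k * N) : ZMod M)) / 2 :=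
      fun m => by
    rw [Complex.ofReal_cos, Complex.cos, mul_neg, AddChar.map_neg_eq_inv,
      show (m * (k * N) : ZMod M) = ((m * (k * N) : ℕ) : ZMod M) by push_cast; ring,
      stdAddChar_natCast, ← Complex.exp_neg]
    congr 3 <;> · push_cast; ring
  have hterm : ∀ m : ℕ, ((Real.cos (2 * Real.pi / M * k * m * N) : ℝ) : ℂ) *
      ((e * ZMod.stdAddChar ((k * m : ℕ) : ZMod M)) ^ N *
        ((e * ZMod.stdAddChar ((k * m : ℕ) : ZMod M))⁻¹ ^ 2) ^ j) =
      e ^ N * (e⁻¹ ^ 2) ^ j / 2 * (ZMod.stdAddChar ((m : ZMod M) * ((2 * k * (N - j) : ℕ) : ZMod M)) +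
        ZMod.stdAddChar ((m : ZMod M) * -((2 * k * j : ℕ) : ZMod M))) := fun m => by
    have e1 : ((ZMod.stdAddChar ((k * m : ℕ) : ZMod M) : ℂ)) ^ N *
        ((ZMod.stdAddChar ((k * m : ℕ) : ZMod M) : ℂ)⁻¹ ^ 2) ^ j =
        ZMod.stdAddChar (m * (k * N - 2 * k * j) : ZMod M) := by
      rw [← AddChar.map_neg_eq_inv, ← AddChar.map_nsmul_eq_pow, ← AddChar.map_nsmul_eq_pow,
        ← AddChar.map_nsmul_eq_pow, ← AddChar.map_add_eq_mul]
      congr 1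
      simp only [nsmul_eq_mul]
      push_cast
      ring
    have e2 : (e * ZMod.stdAddChar ((k * m : ℕ) : ZMod M)) ^ N *
        ((e * ZMod.stdAddChar ((k * m : ℕ) : ZMod M))⁻¹ ^ 2) ^ j =
        e ^ N * (e⁻¹ ^ 2) ^ j * ZMod.stdAddChar (m * (k * N - 2 * k * j) : ZMod M) := by
      rw [← e1, mul_inv, mul_pow, mul_pow, mul_pow]
      ring
    rw [e2, hcos]
    have e3 : (ZMod.stdAddChar ((m : ZMod M) * ((2 * k * (N - j) : ℕ) : ZMod M)) : ℂ) =
        ZMod.stdAddChar (m * (k * N) : ZMod M) *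
          ZMod.stdAddChar (m * (k * N - 2 * k * j) : ZMod M) := by
      rw [← AddChar.map_add_eq_mul]
      congr 1
      push_cast [Nat.cast_sub hj]
      ring
    have e4 : (ZMod.stdAddChar ((m : ZMod M) * -((2 * k * j : ℕ) : ZMod M)) : ℂ) =
        ZMod.stdAddChar (m * -(k * N) : ZMod M) *
          ZMod.stdAddChar (m * (k * N - 2 * k * j) : ZMod M) := by
      rw [← AddChar.map_add_eq_mul]
      congr 1
      push_cast
      ring
    rw [e3, e4]
    ring
  rw [Finset.sum_congr rfl fun m _ => hterm m, ← Finset.mul_sum, Finset.sum_add_distrib,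
    sum_range_stdAddChar, sum_range_stdAddChar]
  simp only [neg_eq_zero, ZMod.natCast_eq_zero_iff]
  split_ifs <;> ring

theorem modeV_eq (r k l m : ℕ) : modeV M N r k l m =
    (Complex.exp ((theta N r : ℝ) * Complex.I) * ZMod.stdAddChar ((k * m : ℕ) : ZMod M)) •
      modeHW M k l := by
  rw [modeV, stdAddChar_natCast, ← Complex.exp_add]
  congr 2
  simp only [phi]
  push_cast
  ring

theorem star_exp_mul_I (x : ℝ) :
    star (Complex.exp (x * Complex.I)) = (Complex.exp (x * Complex.I))⁻¹ := by
  rw [← Complex.exp_neg]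
  change (starRingEnd ℂ) _ = _
  rw [← Complex.exp_conj]
  simp

/-- The measured value as a Laurent polynomial in a phase `c` multiplying `V`. -/
theorem dqc1Z_smul {ι : Type} [Fintype ι] [DecidableEq ι]
    {ρ : Matrix (Fock ι N) (Fock ι N) ℂ} (hρ : ρ.trace = 1) {W V : Matrix ι ι ℂ}
    (hW : Wᴴ * W = 1) (hV : Vᴴ * V = 1) {c : ℂ} (hc : c ≠ 0) (hsc : star c = c⁻¹)
    {Q : ℕ → Matrix (Fock ι N) (Fock ι N) ℂ}
    (hQ : ∀ s : ℂ, fockOp N (Wᴴ * V * W + s • (Wᴴ * V * W)ᴴ) =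
      ∑ j ∈ Finset.range (N + 1), s ^ j • Q j) :
    dqc1Z ρ W (c • V) = ((1 / 2 : ℂ) ^ N *
      ∑ j ∈ Finset.range (N + 1), (ρ * Q j).trace * (c ^ N * (c⁻¹ ^ 2) ^ j)).re := by
  have hcV : (c • V)ᴴ * (c • V) = 1 := by
    rw [Matrix.conjTranspose_smul, Matrix.smul_mul, Matrix.mul_smul, smul_smul, hV, hsc,
      inv_mul_cancel₀ hc, one_smul]
  have hcc : c * c⁻¹ ^ 2 = c⁻¹ := by rw [pow_two, ← mul_assoc, mul_inv_cancel₀ hc, one_mul]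
  have h1 : Wᴴ * (c • V) * W + (Wᴴ * (c • V) * W)ᴴ =
      c • (Wᴴ * V * W + c⁻¹ ^ 2 • (Wᴴ * V * W)ᴴ) := by
    rw [Matrix.mul_smul, Matrix.smul_mul, Matrix.conjTranspose_smul, hsc, smul_add, smul_smul, hcc]
  rw [dqc1Z_eq hρ hW hcV, h1, expect, fockOp_smul, fockOp_smul, hQ]
  refine congrArg Complex.re ?_
  rw [Finset.smul_sum, Finset.smul_sum, Finset.mul_sum, Matrix.trace_sum, Finset.mul_sum]
  refine Finset.sum_congr rfl fun j _ => ?_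
  simp only [Matrix.mul_smul, Matrix.trace_smul, smul_eq_mul]
  ring

/-- The combination of measured values isolates `exp(i N θ_r) ⟨W† Λ_{k,l} W⟩`. -/
theorem dqc1Eval_eq (hM : M.Prime) (hN : 0 < N) (hNM : N < M)
    {ρ : Matrix (Fock (ZMod M) N) (Fock (ZMod M) N) ℂ} (hρ : IsDensity ρ)
    {W : Matrix (ZMod M) (ZMod M) ℂ} (hW : Wᴴ * W = 1) (r : ℕ) {k : ℕ} (hk : 1 ≤ k) (hkM : k < M)
    (l : ℕ) :
    dqc1Eval ρ W r k l = (Complex.exp ((theta N r : ℝ) * Complex.I) ^ N *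
      expect ρ (Wᴴ * modeHW M k l * W)).re := by
  have hM0 : (M : ℂ) ≠ 0 := Nat.cast_ne_zero.2 (NeZero.ne M)
  set e : ℂ := Complex.exp ((theta N r : ℝ) * Complex.I) with he
  have he0 : e ≠ 0 := Complex.exp_ne_zero _
  have hse : star e = e⁻¹ := star_exp_mul_I _
  set U := Wᴴ * modeHW M k l * W with hU
  obtain ⟨Q, hQ0, hQN, hQ⟩ := exists_fockOp_add_smul N U Uᴴ
  let c : ℕ → ℂ := fun m => e * ZMod.stdAddChar ((k * m : ℕ) : ZMod M)
  have hc0 : ∀ m, c m ≠ 0 := fun m => mul_ne_zero he0 (by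
    rw [stdAddChar_natCast]; exact Complex.exp_ne_zero _)
  have hsc : ∀ m, star (c m) = (c m)⁻¹ := fun m => by
    simp only [c]
    rw [star_mul', hse, star_stdAddChar, AddChar.map_neg_eq_inv, mul_inv]
  have hZ : ∀ m, dqc1Z ρ W (modeV M N r k l m) = ((1 / 2 : ℂ) ^ N *
      ∑ j ∈ Finset.range (N + 1), (ρ * Q j).trace * (c m ^ N * ((c m)⁻¹ ^ 2) ^ j)).re :=
      fun m => by
    rw [modeV_eq]
    exact dqc1Z_smul hρ.2 hW (modeHW_unitary k l) (hc0 m) (hsc m) hQ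
  have hsum : ((∑ m ∈ Finset.range M, Real.cos (2 * Real.pi / M * k * m * N) *
      dqc1Z ρ W (modeV M N r k l m) : ℝ)) = ((1 / 2 : ℂ) ^ N * ∑ j ∈ Finset.range (N + 1),
        ((ρ * Q j).trace * (e ^ N * (e⁻¹ ^ 2) ^ j * (M / 2))) *
          ((if M ∣ 2 * k * (N - j) then 1 else 0) + if M ∣ 2 * k * j then 1 else 0)).re := by
    simp only [hZ, ← Complex.re_ofReal_mul]
    rw [← Complex.re_sum]
    congr 1
    simp only [Finset.mul_sum]
    rw [Finset.sum_comm]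
    refine Finset.sum_congr rfl fun j hj => ?_
    have h := sum_cos_mul_phase (M := M) (N := N) (k := k) (e := e)
      (Nat.lt_succ_iff.1 (Finset.mem_range.1 hj))
    calc _ = (1 / 2 : ℂ) ^ N * (ρ * Q j).trace *
          ∑ m ∈ Finset.range M, ((Real.cos (2 * Real.pi / M * k * m * N) : ℝ) : ℂ) *
            (c m ^ N * ((c m)⁻¹ ^ 2) ^ j) := by
          rw [Finset.mul_sum]
          exact Finset.sum_congr rfl fun m _ => by ring
      _ = _ := by rw [h]; ring
  rw [dqc1Eval, hsum]
  have hre : ∀ (x : ℝ) (z : ℂ), x * z.re = ((x : ℂ) * z).re := fun x z => by simp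
  rw [hre]
  have hx := sum_extremal hM hN hNM hk hkM
    (fun j => (ρ * Q j).trace * (e ^ N * (e⁻¹ ^ 2) ^ j * (M / 2)))
  have hfin : ((((2 : ℝ) ^ ((N : ℤ) - if M ∣ 2 * k * N then 1 else 0) / M : ℝ)) : ℂ) *
      ((1 / 2 : ℂ) ^ N * ∑ j ∈ Finset.range (N + 1),
        ((ρ * Q j).trace * (e ^ N * (e⁻¹ ^ 2) ^ j * (M / 2))) *
          ((if M ∣ 2 * k * (N - j) then 1 else 0) + if M ∣ 2 * k * j then 1 else 0)) =
      (e ^ N * expect ρ U + star (e ^ N * expect ρ U)) / 2 := by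
    rw [star_mul', star_pow, hse, ← expect_conjTranspose hρ.1.1]
    simp only [hQ0, hQN] at hx
    rw [sub_eq_add_neg, zpow_add₀ (two_ne_zero)]
    have h3 : (1 / 2 : ℂ) ^ N * 2 ^ N = 1 := by rw [← mul_pow]; norm_num
    have h4 : e ^ N * (e⁻¹ ^ 2) ^ N = e⁻¹ ^ N := by
      rw [← mul_pow, pow_two, ← mul_assoc, mul_inv_cancel₀ he0, one_mul]
    rw [h4, pow_zero, mul_one] at hx
    push_cast
    rw [zpow_natCast]
    calc _ = (1 / M : ℂ) * ((1 / 2 : ℂ) ^ N * 2 ^ N) * ((2 : ℂ) ^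
            (-(if M ∣ 2 * k * N then 1 else 0 : ℤ)) * ∑ j ∈ Finset.range (N + 1),
          ((ρ * Q j).trace * (e ^ N * (e⁻¹ ^ 2) ^ j * (M / 2))) *
          ((if M ∣ 2 * k * (N - j) then 1 else 0) + if M ∣ 2 * k * j then 1 else 0)) := by ring
      _ = _ := by
        rw [h3, hx, expect, expect]
        field_simp
  rw [hfin]
  generalize e ^ N * expect ρ U = z
  simp

theorem exp_theta_zero_pow : Complex.exp ((theta N 0 : ℝ) * Complex.I) ^ N = 1 := by
  simp [theta]

theorem exp_theta_one_pow (hN : 0 < N) :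
    Complex.exp ((theta N 1 : ℝ) * Complex.I) ^ N = -Complex.I := by
  have hN0 : (N : ℂ) ≠ 0 := Nat.cast_ne_zero.2 hN.ne'
  rw [← Complex.exp_nat_mul, ← Complex.exp_neg_pi_div_two_mul_I]
  congr 1
  simp only [theta]
  push_cast
  field_simp

end HW

/-! ### The HW-reduced density matrix -/

section Reconstruction

variable {M : ℕ} [NeZero M] {N : ℕ}

theorem shiftFock_apply (m : ZMod M) (n : Fock (ZMod M) N) (i : ZMod M) :
    (shiftFock m n).1 i = n.1 (i - m) := by
  simp [shiftFock, Finsupp.equivMapDomain_apply, sub_eq_add_neg]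

theorem shiftFock_shiftFock (a b : ZMod M) (n : Fock (ZMod M) N) :
    shiftFock a (shiftFock b n) = shiftFock (a + b) n := by
  refine Subtype.ext (Finsupp.ext fun i => ?_)
  rw [shiftFock_apply, shiftFock_apply, shiftFock_apply, sub_sub]

theorem shiftFock_zero (n : Fock (ZMod M) N) : shiftFock 0 n = n := by
  refine Subtype.ext (Finsupp.ext fun i => ?_)
  rw [shiftFock_apply, sub_zero]

theorem modeIndex_shiftFock (m : ZMod M) (n : Fock (ZMod M) N) :
    modeIndex (shiftFock m n) = modeIndex n + N * m := by
  have hN : (N : ZMod M) = ∑ i, (n.1 i : ZMod M) := by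
    rw [← Nat.cast_sum, n.sum_eq]
  rw [modeIndex, modeIndex, hN, Finset.sum_mul, ← Finset.sum_add_distrib]
  refine (Fintype.sum_equiv (Equiv.addRight m) _ _ fun i => ?_).symm
  rw [shiftFock_apply, Equiv.coe_addRight, add_sub_cancel_right]
  ring

theorem fockOp_modeX_pow (k : ℕ) (ν n : Fock (ZMod M) N) :
    fockOp N (modeX M ^ k) ν n = if ν = shiftFock (k : ZMod M) n then 1 else 0 := by
  have hform : ∀ m : ZMod M, modeForm (modeX M ^ k) m = MvPolynomial.X (m + k) := fun m => by
    rw [modeForm, Finset.sum_eq_single (m + k)]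
    · simp [modeX_pow]
    · intro b _ hb
      simp [modeX_pow, hb]
    · simp
  have hmon : modeSubst (modeX M ^ k) (MvPolynomial.monomial n.1 1) =
      MvPolynomial.monomial (shiftFock (k : ZMod M) n).1 1 := by
    rw [modeSubst_monomial, MvPolynomial.monomial_eq, Finsupp.prod_fintype _ _ (by simp),
      MvPolynomial.C_1, one_mul]
    refine Fintype.prod_equiv (Equiv.addRight (k : ZMod M)) _ _ fun m => ?_
    rw [hform, shiftFock_apply, Equiv.coe_addRight, add_sub_cancel_right]
  have hfac : occFactorial (shiftFock (k : ZMod M) n).1 = occFactorial n.1 := by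
    rw [occFactorial, occFactorial]
    congr 1
    refine (Fintype.prod_equiv (Equiv.addRight (k : ZMod M)) _ _ fun m => ?_).symm
    rw [shiftFock_apply, Equiv.coe_addRight, add_sub_cancel_right]
  rw [fockOp_apply, hmon, MvPolynomial.coeff_monomial]
  by_cases h : ν = shiftFock (k : ZMod M) n
  · rw [if_pos h, if_pos (by rw [h]), h, hfac]
    have := sqrt_occFactorial_ne_zero n.1
    push_cast
    field_simp
  · rw [if_neg h, if_neg fun h' => h (Subtype.ext h'.symm), mul_zero]

theorem fockOp_modeZ_pow (l : ℕ) :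
    fockOp N (modeZ M ^ l) =
      Matrix.diagonal fun n => ZMod.stdAddChar ((l : ZMod M) * modeIndex n) := by
  rw [modeZ_pow, fockOp_diagonal]
  congr 1
  ext n
  simp only [← AddChar.map_nsmul_eq_pow]
  have h := map_prod (ZMod.stdAddChar (N := M)).toMonoidHom
    (fun i => Multiplicative.ofAdd (n.1 i • ((l : ZMod M) * i))) Finset.univ
  refine (h.symm.trans ?_)
  rw [← ofAdd_sum]
  refine congrArg (ZMod.stdAddChar (N := M)) ?_
  rw [modeIndex, Finset.mul_sum]
  exact Finset.sum_congr rfl fun i _ => by rw [nsmul_eq_mul]; ring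

theorem expect_modeHW (ρ : Matrix (Fock (ZMod M) N) (Fock (ZMod M) N) ℂ) (k l : ℕ) :
    expect ρ (modeHW M k l) = ∑ n, ρ n (shiftFock (k : ZMod M) n) *
      ZMod.stdAddChar ((l : ZMod M) * modeIndex n) := by
  rw [expect, modeHW, fockOp_mul, fockOp_modeZ_pow, ← Matrix.mul_assoc, Matrix.trace]
  refine Finset.sum_congr rfl fun n _ => ?_
  rw [Matrix.diag_apply, Matrix.mul_diagonal, Matrix.mul_apply]
  simp [fockOp_modeX_pow]

theorem hwL_apply (k l : ℕ) (a b : ZMod M) : hwL M k l a b = modeHW M k l a b := by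
  rw [hwL, Matrix.of_apply, fockOp_apply, modeSubst_monomial]
  have h1 : ∀ m : ZMod M, occFactorial (singlePhoton M m).1 = 1 := fun m => by
    rw [occFactorial, Finset.prod_eq_one fun i _ => ?_, Nat.cast_one]
    simp only [singlePhoton, Finsupp.single_apply]
    split_ifs <;> simp
  have h2 : ∏ m, modeForm (modeHW M k l) m ^ (singlePhoton M b).1 m =
      modeForm (modeHW M k l) b := by
    rw [Finset.prod_eq_single b]
    · simp [singlePhoton]
    · intro c _ hc
      simp [singlePhoton, Ne.symm hc]
    · simp
  rw [h1, h1, h2, modeForm, MvPolynomial.coeff_sum, Finset.sum_eq_single a]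
  · simp [singlePhoton]
  · intro c _ hc
    simp [singlePhoton, MvPolynomial.coeff_C_mul, MvPolynomial.coeff_X,
      Finsupp.single_left_inj, hc]
  · simp

/-- The Fourier sum over `l` picks the Fock vectors with `μ(n) = N m`. -/
theorem reconstruction_apply (ρ : Matrix (Fock (ZMod M) N) (Fock (ZMod M) N) ℂ) (m m' : ZMod M) :
    ((1 / (M : ℂ)) • ∑ k ∈ Finset.range M, ∑ l ∈ Finset.range M,
      expect ρ (modeHW M k l) • (hwL M k (N * l))ᴴ) m m' =
    ∑ n with modeIndex n = 0, ρ (shiftFock m n) (shiftFock m' n) := by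
  have hM0 : (M : ℂ) ≠ 0 := Nat.cast_ne_zero.2 (NeZero.ne M)
  have hk : ∀ k ∈ Finset.range M, k ≠ (m' - m).val → ¬ m' = m + (k : ZMod M) := by
    intro k hk hne h
    apply hne
    rw [h, add_sub_cancel_left, ZMod.val_natCast_of_lt (Finset.mem_range.1 hk)]
  rw [Matrix.smul_apply, Matrix.sum_apply, Finset.sum_eq_single (m' - m).val]
  · rw [Matrix.sum_apply]
    have hterm : ∀ l, (expect ρ (modeHW M (m' - m).val l) • (hwL M (m' - m).val (N * l))ᴴ) m m' =
        ∑ n, ρ n (shiftFock (m' - m) n) * ZMod.stdAddChar (l * (modeIndex n - N * m) : ZMod M) :=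
        fun l => by
      rw [Matrix.smul_apply, Matrix.conjTranspose_apply, hwL_apply, modeHW_apply, if_pos (by simp),
        star_stdAddChar, expect_modeHW, smul_eq_mul, Finset.sum_mul]
      refine Finset.sum_congr rfl fun n _ => ?_
      rw [mul_assoc, ← AddChar.map_add_eq_mul]
      congr 2
      · simp
      · push_cast; ring
    simp only [hterm]
    rw [Finset.sum_comm]
    simp only [← Finset.mul_sum, sum_range_stdAddChar, sub_eq_zero, mul_ite, mul_zero]
    rw [← Finset.sum_filter, Finset.smul_sum]
    -- shifting by `m` maps `μ = 0` bijectively onto `μ = N m`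
    symm
    refine Finset.sum_bij (fun n _ => shiftFock m n) ?_ ?_ ?_ ?_
    · intro n hn
      rw [Finset.mem_filter] at hn ⊢
      exact ⟨Finset.mem_univ _, by rw [modeIndex_shiftFock, hn.2, zero_add]⟩
    · intro a _ b _ hab
      have := congrArg (shiftFock (-m)) hab
      simpa only [shiftFock_shiftFock, neg_add_cancel, shiftFock_zero] using this
    · intro n hn
      rw [Finset.mem_filter] at hn
      refine ⟨shiftFock (-m) n, ?_, ?_⟩
      · rw [Finset.mem_filter]
        exact ⟨Finset.mem_univ _, by rw [modeIndex_shiftFock, hn.2]; ring⟩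
      · rw [shiftFock_shiftFock, add_neg_cancel, shiftFock_zero]
    · intro n _
      rw [shiftFock_shiftFock, sub_add_cancel, smul_eq_mul]
      field_simp
  · intro k hkr hne
    rw [Matrix.sum_apply]
    refine Finset.sum_eq_zero fun l _ => ?_
    rw [Matrix.smul_apply, Matrix.conjTranspose_apply, hwL_apply, modeHW_apply,
      if_neg (hk k hkr hne), star_zero, smul_zero]
  · intro h
    exact absurd (Finset.mem_range.2 (ZMod.val_lt _)) h

/-- A vanishing diagonal entry of a positive semidefinite matrix makes its whole row vanish. -/
theorem apply_eq_zero_of_diag_eq_zero {κ : Type*} [Fintype κ] {ρ : Matrix κ κ ℂ}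
    (hρ : ρ.PosSemidef) {i : κ} (hi : ρ i i = 0) (j : κ) : ρ i j = 0 := by
  classical
  -- the diagonal entry is the value of the quadratic form at a basis vector
  have h := (hρ.dotProduct_mulVec_zero_iff (Pi.single i 1)).1 (by simp [hi])
  have hj : ρ j i = 0 := by simpa using congrFun h j
  rw [← hρ.1.eq, Matrix.conjTranspose_apply, hj, star_zero]

theorem natCast_photons_ne_zero {M N : ℕ} (hN : 0 < N) (hNM : N < M) : (N : ZMod M) ≠ 0 := by
  rw [Ne, ZMod.natCast_eq_zero_iff]
  exact Nat.not_dvd_of_pos_of_lt hN hNM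

theorem mem_hwOrbit {n ν : Fock (ZMod M) N} : ν ∈ hwOrbit n ↔ ∃ m, shiftFock m n = ν := by
  simp [hwOrbit]

theorem mem_hwOrbit_self (n : Fock (ZMod M) N) : n ∈ hwOrbit n :=
  mem_hwOrbit.2 ⟨0, shiftFock_zero n⟩

variable [Fact M.Prime]

theorem shiftFock_injective (hN : 0 < N) (hNM : N < M) (n : Fock (ZMod M) N) :
    Function.Injective fun m : ZMod M => shiftFock m n := fun a b hab => by
  have h := congrArg modeIndex hab
  simp only [modeIndex_shiftFock] at h
  exact mul_left_cancel₀ (natCast_photons_ne_zero hN hNM) (add_left_cancel h)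

/-- An orbit has at most one representative with `μ = 0`. -/
theorem eq_of_mem_hwOrbit (hN : 0 < N) (hNM : N < M) {n ν : Fock (ZMod M) N}
    (hn : modeIndex n = 0) (hν : ν ∈ hwOrbit n) (hν0 : modeIndex ν = 0) : ν = n := by
  obtain ⟨m, rfl⟩ := mem_hwOrbit.1 hν
  rw [modeIndex_shiftFock, hn, zero_add] at hν0
  rw [(mul_eq_zero.1 hν0).resolve_left (natCast_photons_ne_zero hN hNM), shiftFock_zero]

/-- Every orbit has a representative with `μ = 0`. -/
theorem hwOrbits_eq_image (hN : 0 < N) (hNM : N < M) :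
    hwOrbits M N = (Finset.univ.filter fun n : Fock (ZMod M) N => modeIndex n = 0).image
      hwOrbit := by
  ext E
  simp only [hwOrbits, Finset.mem_image, Finset.mem_univ, true_and, Finset.mem_filter]
  refine ⟨fun ⟨n, hE⟩ => ?_, fun ⟨n, _, hE⟩ => ⟨n, hE⟩⟩
  have hN0 := natCast_photons_ne_zero (M := M) hN hNM
  -- the shift `m` that solves `μ(n) + N m = 0`
  refine ⟨shiftFock (-(modeIndex n) / N) n, ?_, ?_⟩
  · rw [modeIndex_shiftFock]
    field_simp
    ring
  · rw [← hE]
    ext ν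
    rw [mem_hwOrbit, mem_hwOrbit]
    refine ⟨fun ⟨m, h⟩ => ⟨m + -(modeIndex n) / N, by rw [← h, shiftFock_shiftFock]⟩,
      fun ⟨m, h⟩ => ⟨m - -(modeIndex n) / N, by rw [← h, shiftFock_shiftFock, sub_add_cancel]⟩⟩

/-- The weight of an orbit cancels from its block. When it is zero, the division in `hwBlock` has a
junk value, but then the entries of `ρ` on the orbit vanish as well. -/
theorem hwWeight_smul_hwBlock_apply (hN : 0 < N) (hNM : N < M)
    {ρ : Matrix (Fock (ZMod M) N) (Fock (ZMod M) N) ℂ} (hρ : ρ.PosSemidef)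
    {n : Fock (ZMod M) N} (hn : modeIndex n = 0) (m m' : ZMod M) :
    (hwWeight ρ (hwOrbit n) • hwBlock ρ (hwOrbit n)) m m' =
      ρ (shiftFock m n) (shiftFock m' n) := by
  have hM0 : (M : ℂ) ≠ 0 := Nat.cast_ne_zero.2 (NeZero.ne M)
  have hex : ∃ ν ∈ hwOrbit n, modeIndex ν = 0 := ⟨n, mem_hwOrbit_self n, hn⟩
  have hch : hex.choose = n := eq_of_mem_hwOrbit hN hNM hn hex.choose_spec.1 hex.choose_spec.2
  have hcard : (hwOrbit n).card = M := by
    rw [hwOrbit, Finset.card_image_of_injective _ (shiftFock_injective hN hNM n),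
      Finset.card_univ, ZMod.card]
  rw [Matrix.smul_apply, hwBlock, Matrix.of_apply, dif_pos hex, hch, hcard, smul_eq_mul]
  by_cases hw : hwWeight ρ (hwOrbit n) = 0
  · have h := (Finset.sum_eq_zero_iff_of_nonneg fun ν _ => hρ.diag_nonneg).1 hw
      (shiftFock m n) (mem_hwOrbit.2 ⟨m, rfl⟩)
    rw [hw, zero_mul, apply_eq_zero_of_diag_eq_zero hρ h]
  · field_simp

theorem hwReduced_eq (hN : 0 < N) (hNM : N < M)
    {ρ : Matrix (Fock (ZMod M) N) (Fock (ZMod M) N) ℂ} (hρ : ρ.PosSemidef) :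
    hwReduced ρ = (1 / (M : ℂ)) • ∑ k ∈ Finset.range M, ∑ l ∈ Finset.range M,
      expect ρ (modeHW M k l) • (hwL M k (N * l))ᴴ := by
  ext m m'
  rw [reconstruction_apply, hwReduced, hwOrbits_eq_image hN hNM, Matrix.sum_apply,
    Finset.sum_image]
  · refine Finset.sum_congr rfl fun n hn => ?_
    exact hwWeight_smul_hwBlock_apply hN hNM hρ (Finset.mem_filter.1 hn).2 m m'
  · intro a ha b hb hab
    rw [Finset.mem_coe, Finset.mem_filter] at ha hb
    exact eq_of_mem_hwOrbit hN hNM hb.2 (hab ▸ mem_hwOrbit_self a) ha.2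

end Reconstruction

/-! ### Counting the configurations -/

section Configurations

/-- The phases `θ_r + φ_{km}` are distinct modulo `2π`: a coincidence with `r ≠ r'` would make `M` a
multiple of `4`. -/
theorem exp_phase_injective {M N : ℕ} (hM : M.Prime) (hN : 0 < N) {k : ℕ} (hk : 1 ≤ k)
    (hkM : k < M)
    {r r' m m' : ℕ} (hr : r < 2) (hr' : r' < 2) (hm : m < M) (hm' : m' < M)
    (h : Complex.exp (((theta N r + phi M k m : ℝ) : ℂ) * Complex.I) =
      Complex.exp (((theta N r' + phi M k m' : ℝ) : ℂ) * Complex.I)) : r = r' ∧ m = m' := by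
  obtain ⟨n, hn⟩ := Complex.exp_eq_exp_iff_exists_int.1 h
  have hn' : ((theta N r + phi M k m : ℝ) : ℂ) =
      ((theta N r' + phi M k m' + n * (2 * Real.pi) : ℝ) : ℂ) := by
    apply mul_right_cancel₀ Complex.I_ne_zero
    rw [hn]
    push_cast
    ring
  have hr1 := Complex.ofReal_injective hn'
  have hN0 : (N : ℝ) ≠ 0 := Nat.cast_ne_zero.2 hN.ne'
  have hM0 : (M : ℝ) ≠ 0 := Nat.cast_ne_zero.2 hM.ne_zero
  have hpi := Real.pi_ne_zero
  simp only [theta, phi] at hr1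
  field_simp at hr1
  have hz : ((r' : ℤ) - r) * M = 4 * (N * (k * (m' - m) + n * M)) := by
    have : (((r' : ℝ) - r) * M) = 4 * (N * (k * (m' - m) + n * M)) := by
      linear_combination hr1
    exact_mod_cast this
  have h4 : ¬ (4 : ℤ) ∣ M := fun hd => by
    have hd' : 4 ∣ M := by exact_mod_cast hd
    have h2 : 2 ∣ M := (by norm_num : 2 ∣ 4).trans hd'
    have := (Nat.prime_dvd_prime_iff_eq Nat.prime_two hM).1 h2
    omega
  have hrr : r = r' := by
    rcases (by omega : r = r' ∨ (r = 0 ∧ r' = 1) ∨ (r = 1 ∧ r' = 0)) with h | ⟨h, h'⟩ | ⟨h, h'⟩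
    · exact h
    · refine absurd ⟨N * (k * (m' - m) + n * M), ?_⟩ h4
      rw [← hz, h, h']; simp
    · refine absurd ⟨-(N * (k * (m' - m) + n * M)), ?_⟩ h4
      rw [mul_neg, ← hz, h, h']; simp
  refine ⟨hrr, ?_⟩
  rw [hrr, sub_self, zero_mul] at hz
  have hkz : (k : ℤ) * (m' - m) + n * M = 0 := by
    simpa [hN.ne'] using hz.symm
  have hdvd : (M : ℤ) ∣ k * (m' - m) := ⟨-n, by linear_combination hkz⟩
  have hMp : Prime (M : ℤ) := Nat.prime_iff_prime_int.1 hM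
  rcases hMp.dvd_or_dvd hdvd with hd | hd
  · exact absurd (Int.natCast_dvd_natCast.1 hd) (Nat.not_dvd_of_pos_of_lt hk hkM)
  · have hmod : (m : ℤ) ≡ m' [ZMOD M] := Int.modEq_iff_dvd.2 hd
    exact Nat.ModEq.eq_of_lt_of_lt (Int.natCast_modEq_iff.1 hmod) hm hm'

variable {M : ℕ} [NeZero M] {N : ℕ}

/-- A scalar phase and a Heisenberg-Weyl operator are determined by their product. -/
theorem smul_modeHW_injective {c c' : ℂ} (hc : c ≠ 0) {k l k' l' : ℕ} (hk : k < M)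
    (hl : l < M) (hk' : k' < M) (hl' : l' < M) (h : c • modeHW M k l = c' • modeHW M k' l') :
    c = c' ∧ k = k' ∧ l = l' := by
  have hval : ∀ {a b : ℕ}, a < M → b < M → (a : ZMod M) = b → a = b := fun ha hb hab => by
    rwa [ZMod.natCast_eq_natCast_iff', Nat.mod_eq_of_lt ha, Nat.mod_eq_of_lt hb] at hab
  -- column `0` gives the phase and `k`, column `1` then gives `l`
  have h0 := congrFun (congrFun h (k : ZMod M)) 0
  simp only [Matrix.smul_apply, modeHW_apply, zero_add, mul_zero, AddChar.map_zero_eq_one,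
    smul_eq_mul, if_true, mul_one, mul_ite] at h0
  have hkk : (k : ZMod M) = k' := by
    by_contra hne
    rw [if_neg hne] at h0
    exact hc h0
  rw [if_pos hkk] at h0
  have h1 := congrFun (congrFun h (1 + k : ZMod M)) 1
  simp only [Matrix.smul_apply, modeHW_apply, ← hkk, ← h0, smul_eq_mul, if_true, mul_one] at h1
  exact ⟨h0, hval hk hk' hkk, hval hl hl' (ZMod.injective_stdAddChar (mul_left_cancel₀ hc h1))⟩

theorem modeV_injective (hM : M.Prime) (hN : 0 < N) {r k l m r' k' l' m' : ℕ} (hr : r < 2)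
    (hk : 1 ≤ k) (hkM : k < M) (hl : l < M) (hm : m < M) (hr' : r' < 2) (hkM' : k' < M)
    (hl' : l' < M) (hm' : m' < M) (h : modeV M N r k l m = modeV M N r' k' l' m') :
    r = r' ∧ k = k' ∧ l = l' ∧ m = m' := by
  obtain ⟨h1, rfl, rfl⟩ := smul_modeHW_injective (Complex.exp_ne_zero _) hkM hl hkM' hl' h
  obtain ⟨rfl, rfl⟩ := exp_phase_injective hM hN hk hkM hr hr' hm hm' h1
  exact ⟨rfl, rfl, rfl, rfl⟩

theorem IsGenHadamard.ne_one (hM : 1 < M) {H : Matrix (ZMod M) (ZMod M) ℂ}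
    (hH : IsGenHadamard H 1 0) : (1 : Matrix (ZMod M) (ZMod M) ℂ) ≠ H := by
  rintro rfl
  have h := hH.2
  rw [Matrix.conjTranspose_one, Matrix.one_mul, Matrix.mul_one] at h
  have h00 := congrFun (congrFun h 0) 0
  have : Fact (1 < M) := ⟨hM⟩
  rw [modeHW_apply] at h00
  simp [modeZ] at h00

theorem ncard_configurations (hM : M.Prime) (hN : 0 < N) {H : Matrix (ZMod M) (ZMod M) ℂ}
    (hH : IsGenHadamard H 1 0) : (configurations N H).ncard = 2 * M ^ 3 - 2 * M := by
  let S₁ : Finset (ℕ × ℕ × ℕ × ℕ) :=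
    Finset.range 2 ×ˢ Finset.Ico 1 M ×ˢ Finset.range M ×ˢ Finset.range M
  let S₂ : Finset (ℕ × ℕ × ℕ) := Finset.range 2 ×ˢ Finset.Ico 1 M ×ˢ Finset.range M
  let f₁ : ℕ × ℕ × ℕ × ℕ → Matrix (ZMod M) (ZMod M) ℂ × Matrix (ZMod M) (ZMod M) ℂ :=
    fun p => (1, modeV M N p.1 p.2.1 p.2.2.1 p.2.2.2)
  let f₂ : ℕ × ℕ × ℕ → Matrix (ZMod M) (ZMod M) ℂ × Matrix (ZMod M) (ZMod M) ℂ :=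
    fun p => (H, modeV M N p.1 p.2.1 0 p.2.2)
  have hc : configurations N H = f₁ '' S₁ ∪ f₂ '' S₂ := by
    ext c
    simp only [configurations, Set.mem_union, Set.mem_ofPred_eq, Set.mem_image, Finset.mem_coe,
      S₁, S₂, f₁, f₂, Finset.mem_product, Finset.mem_range, Finset.mem_Ico, Prod.exists]
    refine or_congr ⟨?_, ?_⟩ ⟨?_, ?_⟩
    · rintro ⟨r, k, l, m, hr, hk, hkM, hl, hm, rfl⟩
      exact ⟨r, k, l, m, ⟨hr, ⟨hk, hkM⟩, hl, hm⟩, rfl⟩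
    · rintro ⟨r, k, l, m, ⟨hr, ⟨hk, hkM⟩, hl, hm⟩, rfl⟩
      exact ⟨r, k, l, m, hr, hk, hkM, hl, hm, rfl⟩
    · rintro ⟨r, k, m, hr, hk, hkM, hm, rfl⟩
      exact ⟨r, k, m, ⟨hr, ⟨hk, hkM⟩, hm⟩, rfl⟩
    · rintro ⟨r, k, m, ⟨hr, ⟨hk, hkM⟩, hm⟩, rfl⟩
      exact ⟨r, k, m, hr, hk, hkM, hm, rfl⟩
  have hi₁ : Set.InjOn f₁ S₁ := by
    rintro ⟨r, k, l, m⟩ h ⟨r', k', l', m'⟩ h' he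
    simp only [S₁, Finset.mem_coe, Finset.mem_product, Finset.mem_range, Finset.mem_Ico] at h h'
    obtain ⟨rfl, rfl, rfl, rfl⟩ := modeV_injective hM hN h.1 h.2.1.1 h.2.1.2 h.2.2.1 h.2.2.2 h'.1
      h'.2.1.2 h'.2.2.1 h'.2.2.2 (Prod.ext_iff.1 he).2
    rfl
  have hi₂ : Set.InjOn f₂ S₂ := by
    rintro ⟨r, k, m⟩ h ⟨r', k', m'⟩ h' he
    simp only [S₂, Finset.mem_coe, Finset.mem_product, Finset.mem_range, Finset.mem_Ico] at h h'
    obtain ⟨rfl, rfl, -, rfl⟩ := modeV_injective hM hN h.1 h.2.1.1 h.2.1.2 hM.pos h.2.2 h'.1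
      h'.2.1.2 hM.pos h'.2.2 (Prod.ext_iff.1 he).2
    rfl
  have hd : Disjoint (f₁ '' S₁) (f₂ '' S₂) := by
    rw [Set.disjoint_left]
    rintro _ ⟨p, _, rfl⟩ ⟨q, _, hq⟩
    exact hH.ne_one hM.one_lt (Prod.ext_iff.1 hq).1.symm
  rw [hc, Set.ncard_union_eq hd (S₁.finite_toSet.image _) (S₂.finite_toSet.image _),
    hi₁.ncard_image, hi₂.ncard_image, Set.ncard_coe_finset, Set.ncard_coe_finset]
  simp only [S₁, S₂, Finset.card_product, Finset.card_range, Nat.card_Ico]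
  obtain ⟨t, rfl⟩ := Nat.exists_eq_add_of_le hM.one_lt.le
  rw [Nat.add_sub_cancel_left]
  symm
  rw [Nat.sub_eq_iff_eq_add (by nlinarith [Nat.zero_le t, Nat.zero_le (t ^ 2), Nat.zero_le (t ^ 3)])]
  ring

end Configurations

/-! ### Evaluation from measured values -/

section Evaluation

variable {M : ℕ} [NeZero M] {N : ℕ} {ρ : Matrix (Fock (ZMod M) N) (Fock (ZMod M) N) ℂ}

theorem re_im_expect_eq_dqc1Eval (hM : M.Prime) (hN : 0 < N) (hNM : N < M) (hρ : IsDensity ρ)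
    {W : Matrix (ZMod M) (ZMod M) ℂ} (hW : Wᴴ * W = 1) {k : ℕ} (hk : 1 ≤ k) (hkM : k < M) (l : ℕ) :
    (expect ρ (Wᴴ * modeHW M k l * W)).re = dqc1Eval ρ W 0 k l ∧
      (expect ρ (Wᴴ * modeHW M k l * W)).im = dqc1Eval ρ W 1 k l := by
  have h0 := dqc1Eval_eq hM hN hNM hρ hW 0 hk hkM l
  have h1 := dqc1Eval_eq hM hN hNM hρ hW 1 hk hkM l
  rw [exp_theta_zero_pow, one_mul] at h0
  rw [exp_theta_one_pow hN] at h1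
  refine ⟨h0.symm, ?_⟩
  rw [h1, neg_mul, Complex.neg_re, Complex.I_mul_re, neg_neg]

theorem expect_modeHW_eq_dqc1Eval (hM : M.Prime) (hN : 0 < N) (hNM : N < M) (hρ : IsDensity ρ)
    {k : ℕ} (hk : 1 ≤ k) (hkM : k < M) (l : ℕ) :
    (expect ρ (modeHW M k l)).re = dqc1Eval ρ 1 0 k l ∧
      (expect ρ (modeHW M k l)).im = dqc1Eval ρ 1 1 k l := by
  have h := re_im_expect_eq_dqc1Eval hM hN hNM hρ (W := 1) (by simp) hk hkM l
  rwa [Matrix.conjTranspose_one, Matrix.one_mul, Matrix.mul_one] at h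

theorem IsGenHadamard.expect_modeHW_zero_eq_dqc1Eval {H : Matrix (ZMod M) (ZMod M) ℂ}
    (hH : IsGenHadamard H 1 0) (hM : M.Prime) (hN : 0 < N) (hNM : N < M) (hρ : IsDensity ρ)
    {l : ℕ} (hl : 1 ≤ l) (hlM : l < M) :
    (expect ρ (modeHW M 0 l)).re = dqc1Eval ρ H 0 l 0 ∧
      (expect ρ (modeHW M 0 l)).im = dqc1Eval ρ H 1 l 0 := by
  have h := re_im_expect_eq_dqc1Eval hM hN hNM hρ (Matrix.mem_unitaryGroup_iff'.1 hH.1) hl hlM 0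
  rwa [hH.conjTranspose_mul_modeHW_mul] at h

theorem expect_modeHW_zero_zero (hρ : IsDensity ρ) : expect ρ (modeHW M 0 0) = 1 := by
  rw [modeHW, pow_zero, pow_zero, Matrix.mul_one, expect, fockOp_one, Matrix.mul_one, hρ.2]

theorem dqc1Eval_congr {σ : Matrix (Fock (ZMod M) N) (Fock (ZMod M) N) ℂ}
    {W : Matrix (ZMod M) (ZMod M) ℂ} {r k l : ℕ}
    (h : ∀ m < M, dqc1Z ρ W (modeV M N r k l m) = dqc1Z σ W (modeV M N r k l m)) :
    dqc1Eval ρ W r k l = dqc1Eval σ W r k l := by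
  unfold dqc1Eval
  exact congrArg _ (Finset.sum_congr rfl fun m hm => congrArg _ (h m (Finset.mem_range.1 hm)))

/-- The values measured in the counted configurations determine every `⟨Λ_{k,l}⟩`. -/
theorem expect_modeHW_congr (hM : M.Prime) (hN : 0 < N) (hNM : N < M)
    {H : Matrix (ZMod M) (ZMod M) ℂ} (hH : IsGenHadamard H 1 0)
    {σ : Matrix (Fock (ZMod M) N) (Fock (ZMod M) N) ℂ} (hρ : IsDensity ρ) (hσ : IsDensity σ)
    (h : ∀ c ∈ configurations N H, dqc1Z ρ c.1 c.2 = dqc1Z σ c.1 c.2) {k l : ℕ} (hk : k < M)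
    (hl : l < M) : expect ρ (modeHW M k l) = expect σ (modeHW M k l) := by
  rcases Nat.eq_zero_or_pos k with rfl | hk0
  · rcases Nat.eq_zero_or_pos l with rfl | hl0
    · rw [expect_modeHW_zero_zero hρ, expect_modeHW_zero_zero hσ]
    · have hE : ∀ r < 2, dqc1Eval ρ H r l 0 = dqc1Eval σ H r l 0 := fun r hr =>
        dqc1Eval_congr fun m hm => h (H, modeV M N r l 0 m)
          (Or.inr ⟨r, l, m, hr, hl0, hl, hm, rfl⟩)
      have h₁ := hH.expect_modeHW_zero_eq_dqc1Eval hM hN hNM hρ hl0 hl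
      have h₂ := hH.expect_modeHW_zero_eq_dqc1Eval hM hN hNM hσ hl0 hl
      exact Complex.ext (by rw [h₁.1, h₂.1, hE 0 (by norm_num)])
        (by rw [h₁.2, h₂.2, hE 1 (by norm_num)])
  · have hE : ∀ r < 2, dqc1Eval ρ 1 r k l = dqc1Eval σ 1 r k l := fun r hr =>
      dqc1Eval_congr fun m hm => h (1, modeV M N r k l m)
        (Or.inl ⟨r, k, l, m, hr, hk0, hk, hl, hm, rfl⟩)
    have h₁ := expect_modeHW_eq_dqc1Eval hM hN hNM hρ hk0 hk l
    have h₂ := expect_modeHW_eq_dqc1Eval hM hN hNM hσ hk0 hk l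
    exact Complex.ext (by rw [h₁.1, h₂.1, hE 0 (by norm_num)])
      (by rw [h₁.2, h₂.2, hE 1 (by norm_num)])

/-- `ρ_HW` factors through the values measured in the counted configurations, because the
reconstruction formula expresses it by the `⟨Λ_{k,l}⟩`. -/
theorem exists_hwReduced_eq [Fact M.Prime] (hN : 0 < N) (hNM : N < M)
    {H : Matrix (ZMod M) (ZMod M) ℂ} (hH : IsGenHadamard H 1 0) :
    ∃ R : (configurations N H → ℝ) → Matrix (ZMod M) (ZMod M) ℂ,
      ∀ ρ : Matrix (Fock (ZMod M) N) (Fock (ZMod M) N) ℂ, IsDensity ρ →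
        hwReduced ρ = R fun c => dqc1Z ρ c.1.1 c.1.2 := by
  let data : {ρ : Matrix (Fock (ZMod M) N) (Fock (ZMod M) N) ℂ // IsDensity ρ} →
      configurations N H → ℝ := fun ρ c => dqc1Z ρ.1 c.1.1 c.1.2
  have hfac : Function.FactorsThrough (fun ρ : {ρ : Matrix (Fock (ZMod M) N) (Fock (ZMod M) N) ℂ //
      IsDensity ρ} => hwReduced ρ.1) data := fun ρ σ h => by
    change hwReduced ρ.1 = hwReduced σ.1
    rw [hwReduced_eq hN hNM ρ.2.1, hwReduced_eq hN hNM σ.2.1]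
    refine congrArg _ (Finset.sum_congr rfl fun k hk => Finset.sum_congr rfl fun l hl => ?_)
    rw [expect_modeHW_congr Fact.out hN hNM hH ρ.2 σ.2 (fun c hc => congrFun h ⟨c, hc⟩)
      (Finset.mem_range.1 hk) (Finset.mem_range.1 hl)]
  exact ⟨Function.extend data (fun ρ => hwReduced ρ.1) 0,
    fun ρ hρ => (hfac.extend_apply 0 ⟨ρ, hρ⟩).symm⟩

end Evaluation

end HWReconstruction

theorem corollary1 (M N : ℕ) [Fact M.Prime] (hN : 0 < N) (hNM : N < M) :
    -- a generalized Hadamard transform `H_{1,0}` exists, and any one can be used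
    (∃ H : Matrix (ZMod M) (ZMod M) ℂ, HWReconstruction.IsGenHadamard H 1 0) ∧
    ∀ H : Matrix (ZMod M) (ZMod M) ℂ, HWReconstruction.IsGenHadamard H 1 0 →
      -- number of measurement configurations
      (HWReconstruction.configurations N H).ncard = 2 * M ^ 3 - 2 * M ∧
      (∀ ρ : Matrix (HWReconstruction.Fock (ZMod M) N) (HWReconstruction.Fock (ZMod M) N) ℂ,
        HWReconstruction.IsDensity ρ →
        -- reconstruction formula
        HWReconstruction.hwReduced ρ =
          (1 / (M : ℂ)) • ∑ k ∈ Finset.range M, ∑ l ∈ Finset.range M,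
            HWReconstruction.expect ρ (HWReconstruction.modeHW M k l) •
              (HWReconstruction.hwL M k (N * l))ᴴ ∧
        -- evaluation of `⟨Λ_{k,l}⟩`, `k ≥ 1`, with `W = 1`
        (∀ k l : ℕ, 1 ≤ k → k < M → l < M →
          (HWReconstruction.expect ρ (HWReconstruction.modeHW M k l)).re =
            HWReconstruction.dqc1Eval ρ 1 0 k l ∧
          (HWReconstruction.expect ρ (HWReconstruction.modeHW M k l)).im =
            HWReconstruction.dqc1Eval ρ 1 1 k l) ∧
        -- evaluation of `⟨Λ_{0,l}⟩`, `l ≥ 1`, with `W = H_{1,0}`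
        (∀ l : ℕ, 1 ≤ l → l < M →
          (HWReconstruction.expect ρ (HWReconstruction.modeHW M 0 l)).re =
            HWReconstruction.dqc1Eval ρ H 0 l 0 ∧
          (HWReconstruction.expect ρ (HWReconstruction.modeHW M 0 l)).im =
            HWReconstruction.dqc1Eval ρ H 1 l 0) ∧
        HWReconstruction.expect ρ (HWReconstruction.modeHW M 0 0) = 1) ∧
      -- the counted configurations alone determine the HW-reduced density matrix
      (∃ R : (HWReconstruction.configurations N H → ℝ) → Matrix (ZMod M) (ZMod M) ℂ,
        ∀ ρ : Matrix (HWReconstruction.Fock (ZMod M) N) (HWReconstruction.Fock (ZMod M) N) ℂ,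
          HWReconstruction.IsDensity ρ →
            HWReconstruction.hwReduced ρ =
              R fun c => HWReconstruction.dqc1Z ρ c.1.1 c.1.2) := by
  have hM : M.Prime := Fact.out
  refine ⟨HWReconstruction.exists_isGenHadamard, fun H hH => ⟨
    HWReconstruction.ncard_configurations hM hN hH, fun ρ hρ => ⟨
      HWReconstruction.hwReduced_eq hN hNM hρ.1,
      fun k l hk hkM _ => HWReconstruction.expect_modeHW_eq_dqc1Eval hM hN hNM hρ hk hkM l,
      fun l hl hlM => hH.expect_modeHW_zero_eq_dqc1Eval hM hN hNM hρ hl hlM,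
      HWReconstruction.expect_modeHW_zero_zero hρ⟩,
    HWReconstruction.exists_hwReduced_eq hN hNM hH⟩⟩
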